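/- Let $n\ge 1$ and let $H=-\Delta+|x|^2$ be the Hermite operator on $\mathbb R^n$. Let $\Phi_\alpha$ ($\alpha\in\mathbb N^n$) be the $L^2$-normalized Hermite functions, $H\Phi_\alpha=(2|\alpha|+n)\Phi_\alpha$, and let $e^{-tH}\varphi=\sum_\alpha e^{-(2|\alpha|+n)t}(\varphi,\Phi_\alpha)\Phi_\alpha$ be the Hermite semigroup on $L^2(\mathbb R^n)$. For $t>0$ let the Hermite–Bergman space $\mathcal H_t(\mathbb C^n)$ be the space of entire functions $F$ on $\mathbb C^n$ whose restriction to $\mathbb R^n$ equals $e^{-tH}\varphi$ (almost everywhere) for some $\varphi\in L^2(\mathbb R^n)$, and put $\mathcal H_\infty(\mathbb C^n)=\bigcap_{t>0}\mathcal H_t(\mathbb C^n)$. Write $\hat f(\xi)=(2\pi)^{-n/2}\int_{\mathbb R^n}f(x)e^{-ix\cdot\xi}\,dx$ and $z^2=z_1^2+\dots+z_n^2$. Theorem. Let $F$ be an entire function on $\mathbb C^n$ and let $f$ be its restriction to $\mathbb R^n$. Then $F\in\mathcal H_\infty(\mathbb C^n)$ if and only if $f$ satisfies the Pfannschmidt condition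 with $a=b=1$, that is, there are functions $P,Q:\mathbb R^n\to(0,\infty)$ such that $$|f(x)|\le P(x)e^{-\frac12|x|^2},\qquad |\hat f(\xi)|\le Q(\xi)e^{-\frac12|\xi|^2}\qquad\text{for all }x,\xi\in\mathbb R^n,$$ $$\limsup_{|x|\to\infty}\frac{\log P(x)}{|x|^2}=0=\limsup_{|\xi|\to\infty}\frac{\log Q(\xi)}{|\xi|^2}.$$ (As $f$ is continuous, the bound on $f$ makes it integrable, so that $\hat f$ is defined.) If $F\in\mathcal H_\infty(\mathbb C^n)$, then $f$ is integrable, there is $G\in\mathcal H_\infty(\mathbb C^n)$ with $G=\hat f$ on $\mathbb R^n$, and both $F(z)e^{z^2/2}$ and $G(z)e^{z^2/2}$ are entire functions on $\mathbb C^n$ of order $2$ and at most of minimal type; that is, each of them is an entire function $R$ such that for every $\varepsilon>0$ there is a constant $C_\varepsilon$ with $|R(z)|\le C_\varepsilon e^{\varepsilon|z|^2}$ for all $z\in\mathbb C^n$. -/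

import Mathlib

open MeasureTheory Filter Topology

noncomputable section

/-- The inclusion of `ℝⁿ` into `ℂⁿ` (both with their Euclidean norms). -/
def realToComplex {n : ℕ} (x : EuclideanSpace ℝ (Fin n)) : EuclideanSpace ℂ (Fin n) :=
  WithLp.toLp 2 (fun j => (x j : ℂ))

/-- The restriction to `ℝⁿ` of a function on `ℂⁿ`. -/
def realRestriction {n : ℕ} (F : EuclideanSpace ℂ (Fin n) → ℂ) :
    EuclideanSpace ℝ (Fin n) → ℂ :=
  fun x => F (realToComplex x)

/-- The `k`-th Hermite function on `ℝ`, normalized in `L²(ℝ)`: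
`h_k(x) = (2^k k! √π)^(-1/2) H_k(x) exp(-x²/2)`. Mathlib's `Polynomial.hermite k` is the
probabilists' polynomial `He_k`, and `H_k(x) = 2^(k/2) He_k(√2 x)`, so the powers of `2`
cancel. -/
def hermiteFun (k : ℕ) (x : ℝ) : ℝ :=
  (Real.sqrt (k.factorial * Real.sqrt Real.pi))⁻¹ *
    Polynomial.aeval (Real.sqrt 2 * x) (Polynomial.hermite k) * Real.exp (-x ^ 2 / 2)

/-- The Hermite functions `Φ_α(x) = ∏ j, h_{α_j}(x_j)` on `ℝⁿ`. They form an orthonormal basis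
of `L²(ℝⁿ)` and `H Φ_α = (2|α| + n) Φ_α` for the Hermite operator `H = -Δ + |x|²`. -/
def hermiteFunction {n : ℕ} (α : Fin n → ℕ) (x : EuclideanSpace ℝ (Fin n)) : ℝ :=
  ∏ j, hermiteFun (α j) (x j)

/-- The Hermite coefficient `(φ, Φ_α)` (the functions `Φ_α` are real valued). -/
def hermiteCoeff {n : ℕ} (φ : EuclideanSpace ℝ (Fin n) → ℂ) (α : Fin n → ℕ) : ℂ :=
  ∫ x, φ x * (hermiteFunction α x : ℂ)

/-- `g = e^{-tH} φ` in `L²(ℝⁿ)`, where `H = -Δ + |x|²`: the unconditional `L²`-convergence of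
`g = ∑_α e^{-(2|α| + n)t} (φ, Φ_α) Φ_α`. -/
def IsHermiteSemigroup {n : ℕ} (t : ℝ) (φ g : EuclideanSpace ℝ (Fin n) → ℂ) : Prop :=
  Tendsto
    (fun s : Finset (Fin n → ℕ) =>
      eLpNorm
        (fun x => g x - ∑ α ∈ s,
          (Real.exp (-((2 * ∑ j, (α j : ℝ)) + n) * t) : ℂ) * hermiteCoeff φ α *
            (hermiteFunction α x : ℂ))
        2 volume)
    atTop (𝓝 0)

/-- The Hermite-Bergman space `H_t(ℂⁿ)`: the image of `L²(ℝⁿ)` under `e^{-tH}`, each element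
being identified with its entire extension to `ℂⁿ`. -/
def HermiteBergman (n : ℕ) (t : ℝ) : Set (EuclideanSpace ℂ (Fin n) → ℂ) :=
  {F | Differentiable ℂ F ∧
    ∃ φ : EuclideanSpace ℝ (Fin n) → ℂ,
      MemLp φ 2 volume ∧ IsHermiteSemigroup t φ (realRestriction F)}

/-- `H_∞(ℂⁿ) = ⋂_{t > 0} H_t(ℂⁿ)`. -/
def HermiteBergmanInf (n : ℕ) : Set (EuclideanSpace ℂ (Fin n) → ℂ) :=
  ⋂ t ∈ Set.Ioi (0 : ℝ), HermiteBergman n t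

/-- The unitarily normalized Fourier transform of an integrable function `f` on `ℝⁿ`,
`(2π)^(-n/2) ∫ f(x) exp(-i x·ξ) dx`. -/
def unitaryFourier {n : ℕ} (f : EuclideanSpace ℝ (Fin n) → ℂ)
    (ξ : EuclideanSpace ℝ (Fin n)) : ℂ :=
  (((2 * Real.pi) ^ (-(n : ℝ) / 2) : ℝ) : ℂ) *
    ∫ x, Complex.exp (-Complex.I * ((inner ℝ x ξ : ℝ) : ℂ)) * f x

/-- `limsup_{|x| → ∞} log P(x) / |x|² = 0` for a positive function `P` on `ℝⁿ`. The limsup is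
taken in the extended reals, so that it is the true one also when the quotient is unbounded. -/
def LogLimsupZero {n : ℕ} (P : EuclideanSpace ℝ (Fin n) → ℝ) : Prop :=
  limsup (fun x => ((Real.log (P x) / ‖x‖ ^ 2 : ℝ) : EReal))
    (Bornology.cobounded (EuclideanSpace ℝ (Fin n))) = 0

/-- The Pfannschmidt condition with parameters `a, b`. It is applied below only to continuous
`f`, for which the bound on `f` (with `a > 0`) makes `f` integrable. -/
def PfannschmidtCondition {n : ℕ} (a b : ℝ) (f : EuclideanSpace ℝ (Fin n) → ℂ) : Prop :=
  Measurable f ∧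
  ∃ P Q : EuclideanSpace ℝ (Fin n) → ℝ,
    (∀ x, 0 < P x) ∧ (∀ ξ, 0 < Q ξ) ∧
    (∀ x, ‖f x‖ ≤ P x * Real.exp (-(1 / 2) * a * ‖x‖ ^ 2)) ∧
    (∀ ξ, ‖unitaryFourier f ξ‖ ≤ Q ξ * Real.exp (-(1 / 2) * b * ‖ξ‖ ^ 2)) ∧
    LogLimsupZero P ∧ LogLimsupZero Q

/-- `R` is entire on `ℂⁿ`, of order 2 and at most of minimal type, in the usual sense of a
growth bound: for every `ε > 0`, `|R(z)| = O(exp(ε|z|²))`. Equivalently the order of `R` is at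
most `2` and, if it equals `2`, the type of `R` is `0`. -/
def IsEntireOrderTwoMinimalType {n : ℕ} (R : EuclideanSpace ℂ (Fin n) → ℂ) : Prop :=
  Differentiable ℂ R ∧
    ∀ ε : ℝ, 0 < ε → ∃ C : ℝ, ∀ z, ‖R z‖ ≤ C * Real.exp (ε * ‖z‖ ^ 2)

/-- The function `z ↦ F(z) exp(z²/2)` on `ℂⁿ`, where `z² = ∑ j, z_j²`. -/
def mulExpHalfSq {n : ℕ} (F : EuclideanSpace ℂ (Fin n) → ℂ) :
    EuclideanSpace ℂ (Fin n) → ℂ :=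
  fun z => F z * Complex.exp ((1 / 2) * ∑ j, z j ^ 2)

end

/-
The functions in `H_∞(ℂⁿ)` are exactly the sums of Hermite series whose coefficients decay faster
than every geometric sequence. Up to the weights `1 / √(α!)`, the Bargmann transform turns the
Hermite coefficients of `f` into Taylor coefficients, and it turns the Fourier transform into the
rotation `z ↦ -iz`. The Gaussian bounds on `f` and on its Fourier transform therefore bound the
Bargmann transform by `exp(|im z|² / 2 + ε |re z|²)` and by `exp(|re z|² / 2 + ε |im z|²)`,
respectively. On the curves `ζ ↦ e^ζ a + e^{-ζ} b` with `a`, `b` real, which interpolate between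
real and imaginary directions, the Phragmén–Lindelöf principle in a strip turns these two bounds
into minimal type, and Cauchy's estimates then give the decay of the Hermite coefficients.
-/

noncomputable section

section MultiIndexSeries

theorem hasSum_prod_pi {κ R : Type*} [NormedCommRing R] [CompleteSpace R] {n : ℕ}
    {f : Fin n → κ → R} {a : Fin n → R} (hf : ∀ j, HasSum (f j) (a j))
    (hs : ∀ j, Summable fun k => ‖f j k‖) :
    HasSum (fun α : Fin n → κ => ∏ j, f j (α j)) (∏ j, a j) ∧
      Summable fun α : Fin n → κ => ‖∏ j, f j (α j)‖ := by
  induction n with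
  | zero => simp [hasSum_unique, Summable.of_finite]
  | succ n ih =>
    obtain ⟨hsum, hsumm⟩ := ih (fun j => hf j.succ) (fun j => hs j.succ)
    have hnorm := Summable.mul_norm (hs 0) hsumm
    have hmul := (hf 0).mul hsum hnorm.of_norm
    rw [← (Fin.consEquiv fun _ => κ).hasSum_iff, ← (Fin.consEquiv fun _ => κ).summable_iff]
    simpa [Function.comp_def, Fin.prod_univ_succ, Fin.consEquiv] using And.intro hmul hnorm

variable {ι : Type*} [Fintype ι]

/-- The length `|α| = ∑ j, α j` of a multi-index. -/
def multiDegree (α : ι → ℕ) : ℕ := ∑ j, α j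

theorem prod_pow_eq_pow_multiDegree {R : Type*} [CommMonoid R] (x : R) (α : ι → ℕ) :
    ∏ j, x ^ α j = x ^ multiDegree α :=
  Finset.prod_pow_eq_pow_sum _ _ _

theorem prod_mul_pow {R : Type*} [CommMonoid R] (x : R) (z : ι → R) (α : ι → ℕ) :
    ∏ j, (x * z j) ^ α j = x ^ multiDegree α * ∏ j, z j ^ α j := by
  simp only [mul_pow, Finset.prod_mul_distrib, prod_pow_eq_pow_multiDegree]

theorem summable_pow_multiDegree {ρ : ℝ} (h0 : 0 ≤ ρ) (h1 : ρ < 1) :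
    Summable fun α : ι → ℕ => ρ ^ multiDegree α := by
  have h := summable_geometric_of_lt_one h0 h1
  let e := Fintype.equivFin ι
  rw [← (e.symm.arrowCongr (.refl ℕ)).summable_iff]
  simpa [Function.comp_def, prod_pow_eq_pow_multiDegree, multiDegree, e.sum_comp] using
    (hasSum_prod_pi (fun _ : Fin (Fintype.card ι) => h.hasSum) fun _ => h.norm).1.summable

theorem norm_prod_pow_le {z : ι → ℂ} {r : ℝ} (hz : ∀ j, ‖z j‖ ≤ r) (α : ι → ℕ) :
    ‖∏ j, z j ^ α j‖ ≤ r ^ multiDegree α := by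
  rw [norm_prod, ← prod_pow_eq_pow_multiDegree]
  refine Finset.prod_le_prod (fun _ _ => norm_nonneg _) fun j _ => ?_
  rw [norm_pow]
  exact pow_le_pow_left₀ (norm_nonneg _) (hz j) _

/-- Coefficient families that decay faster than every geometric sequence: the Taylor coefficients
of entire functions, and the Hermite coefficients of the elements of `ℋ_∞(ℂⁿ)`. -/
def RapidDecay (c : (ι → ℕ) → ℂ) : Prop :=
  ∀ T : ℝ, 0 ≤ T → Summable fun α => ‖c α‖ * T ^ multiDegree α

namespace RapidDecay

variable {b c : (ι → ℕ) → ℂ}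

theorem of_bound (h : ∀ T : ℝ, 0 < T → ∃ C, ∀ α, ‖c α‖ * T ^ multiDegree α ≤ C) :
    RapidDecay c := by
  intro T hT
  obtain ⟨C, hC⟩ := h (2 * (T + 1)) (by positivity)
  refine Summable.of_nonneg_of_le (fun α => by positivity) (fun α => ?_)
    ((summable_pow_multiDegree (ρ := 1 / 2) (by norm_num) (by norm_num)).mul_left C)
  calc ‖c α‖ * T ^ multiDegree α
      ≤ ‖c α‖ * (2 * (T + 1) * (1 / 2)) ^ multiDegree α := by gcongr; linarith
    _ = ‖c α‖ * (2 * (T + 1)) ^ multiDegree α * (1 / 2) ^ multiDegree α := by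
        rw [mul_pow, mul_assoc]
    _ ≤ C * (1 / 2) ^ multiDegree α := by gcongr; exact hC α

theorem of_norm_le (hb : RapidDecay b) {A B : ℝ} (hB : 0 ≤ B)
    (h : ∀ α, ‖c α‖ ≤ A * (‖b α‖ * B ^ multiDegree α)) : RapidDecay c := by
  intro T hT
  refine Summable.of_nonneg_of_le (fun α => by positivity) (fun α => ?_)
    ((hb (B * T) (by positivity)).mul_left A)
  calc ‖c α‖ * T ^ multiDegree α
      ≤ A * (‖b α‖ * B ^ multiDegree α) * T ^ multiDegree α := by gcongr; exact h α
    _ = A * (‖b α‖ * (B * T) ^ multiDegree α) := by rw [mul_pow]; ring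

theorem sub (hb : RapidDecay b) (hc : RapidDecay c) : RapidDecay (b - c) := by
  intro T hT
  refine Summable.of_nonneg_of_le (fun α => by positivity) (fun α => ?_) ((hb T hT).add (hc T hT))
  rw [← add_mul]
  gcongr
  exact norm_sub_le _ _

theorem summable_norm_mul (hc : RapidDecay c) {h : (ι → ℕ) → ℂ} {D B : ℝ} (hB : 0 ≤ B)
    (hh : ∀ α, ‖h α‖ ≤ D * B ^ multiDegree α) : Summable fun α => ‖c α * h α‖ := by
  refine Summable.of_nonneg_of_le (fun α => norm_nonneg _) (fun α => ?_) ((hc B hB).mul_left D)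
  calc ‖c α * h α‖ = ‖c α‖ * ‖h α‖ := norm_mul _ _
    _ ≤ ‖c α‖ * (D * B ^ multiDegree α) := by gcongr; exact hh α
    _ = D * (‖c α‖ * B ^ multiDegree α) := by ring

theorem summable_mul_prod_pow (hc : RapidDecay c) (z : ι → ℂ) :
    Summable fun α => c α * ∏ j, z j ^ α j :=
  (hc.summable_norm_mul (D := 1) (B := ‖z‖) (norm_nonneg z) fun α => by
    rw [one_mul]
    exact norm_prod_pow_le (norm_le_pi_norm z) α).of_norm

theorem differentiable_tsum (hc : RapidDecay c) {E : Type*} [NormedAddCommGroup E]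
    [NormedSpace ℂ E] {h : (ι → ℕ) → E → ℂ} (hd : ∀ α, Differentiable ℂ (h α))
    (hb : ∀ R : ℝ, ∃ D B : ℝ, 0 ≤ B ∧ ∀ α z, ‖z‖ ≤ R → ‖h α z‖ ≤ D * B ^ multiDegree α) :
    Differentiable ℂ fun z => ∑' α, c α * h α z := by
  intro z₀
  obtain ⟨D, B, hB, hDB⟩ := hb (‖z₀‖ + 2)
  let _ : NormedSpace ℝ E := NormedSpace.restrictScalars ℝ ℂ E
  have hz₀ : z₀ ∈ Metric.ball z₀ 1 := Metric.mem_ball_self one_pos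
  have hball : ∀ x ∈ Metric.ball z₀ 1, ∀ y ∈ Metric.ball x 1, ‖y‖ ≤ ‖z₀‖ + 2 := by
    intro x hx y hy
    have := norm_le_norm_add_norm_sub' y z₀
    have := dist_triangle y x z₀
    rw [Metric.mem_ball] at hx hy
    rw [← dist_eq_norm] at *
    linarith
  refine (hasFDerivAt_tsum_of_isPreconnected (𝕜 := ℂ) (f := fun α z => c α * h α z)
    (f' := fun α z => c α • fderiv ℂ (h α) z) ((hc B hB).mul_left (2 * D)) Metric.isOpen_ball
    (convex_ball z₀ 1).isPreconnected (fun α x _ => (hd α x).hasFDerivAt.const_mul (c α)) ?_ hz₀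
    (hc.summable_norm_mul hB fun α => hDB α z₀ (by linarith)).of_norm hz₀).differentiableAt
  intro α x hx
  have hderiv : ‖fderiv ℂ (h α) x‖ ≤ 2 * (D * B ^ multiDegree α) / 1 := by
    refine Complex.norm_fderiv_le_div_of_mapsTo_ball (hd α).differentiableOn (fun y hy => ?_)
      one_pos
    rw [Metric.mem_closedBall, dist_eq_norm]
    have := norm_sub_le (h α y) (h α x)
    linarith [hDB α y (hball x hx y hy), hDB α x (hball x hx x (Metric.mem_ball_self one_pos))]
  calc ‖c α • fderiv ℂ (h α) x‖ = ‖c α‖ * ‖fderiv ℂ (h α) x‖ := norm_smul _ _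
    _ ≤ ‖c α‖ * (2 * (D * B ^ multiDegree α) / 1) := by gcongr
    _ = 2 * D * (‖c α‖ * B ^ multiDegree α) := by ring

end RapidDecay

attribute [local instance] instMeasureSpaceUnitAddCircle

theorem norm_coeff_le_norm_tsum_mFourier {κ : Type*} {m : κ → ι → ℤ} (hm : m.Injective)
    {c : κ → ℂ} (hc : Summable fun k => ‖c k‖) (k₀ : κ) :
    ‖c k₀‖ ≤ ‖∑' k, c k • UnitAddTorus.mFourier (m k)‖ := by
  classical
  have : IsProbabilityMeasure (volume : Measure UnitAddCircle) :=
    inferInstanceAs (IsProbabilityMeasure AddCircle.haarAddCircle)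
  let L : C(UnitAddTorus ι, ℂ) →L[ℂ] ℂ :=
    (innerSL ℂ (UnitAddTorus.mFourierLp 2 (m k₀))).comp (ContinuousMap.toLp 2 volume ℂ)
  have hL (k : κ) : L (UnitAddTorus.mFourier (m k)) = if k = k₀ then 1 else 0 := by
    have := orthonormal_iff_ite.1 (UnitAddTorus.orthonormal_mFourier (d := ι)) (m k₀) (m k)
    simpa [L, hm.eq_iff, eq_comm] using this
  have hnorm : ‖L‖ ≤ 1 := by
    refine (ContinuousLinearMap.opNorm_comp_le _ _).trans ?_
    rw [innerSL_apply_norm, UnitAddTorus.orthonormal_mFourier.1, one_mul]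
    refine (ContinuousMap.toLp_norm_le (p := 2) (μ := volume) (𝕜 := ℂ)).trans ?_
    simp [measureUnivNNReal]
  have hsum : Summable fun k => c k • UnitAddTorus.mFourier (m k) :=
    Summable.of_norm (by simpa only [norm_smul, UnitAddTorus.mFourier_norm, mul_one] using hc)
  have hval : L (∑' k, c k • UnitAddTorus.mFourier (m k)) = c k₀ := by
    rw [L.map_tsum hsum]
    simp [hL]
  simpa only [hval, one_mul] using L.le_of_opNorm_le hnorm (∑' k, c k • UnitAddTorus.mFourier (m k))

theorem norm_coeff_mul_pow_le {b : (ι → ℕ) → ℂ} {r : ℝ} (hr : 0 ≤ r)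
    (hs : Summable fun α => ‖b α‖ * r ^ multiDegree α) {M : ℝ}
    (hM : ∀ z : ι → ℂ, (∀ j, ‖z j‖ = r) → ‖∑' α, b α * ∏ j, z j ^ α j‖ ≤ M) (β : ι → ℕ) :
    ‖b β‖ * r ^ multiDegree β ≤ M := by
  let c : (ι → ℕ) → ℂ := fun α => b α * (r : ℂ) ^ multiDegree α
  have hc (α : ι → ℕ) : ‖c α‖ = ‖b α‖ * r ^ multiDegree α := by simp [c, abs_of_nonneg hr]
  let m : (ι → ℕ) → ι → ℤ := fun α j => α j
  have hm : m.Injective := fun α β h => funext fun j => Nat.cast_injective (congrFun h j)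
  have hterm (α : ι → ℕ) (t : UnitAddTorus ι) : c α * UnitAddTorus.mFourier (m α) t =
      b α * ∏ j, ((r : ℂ) * fourier 1 (t j)) ^ α j := by
    rw [prod_mul_pow, ← mul_assoc]
    congr 1
    refine Finset.prod_congr rfl fun j _ => ?_
    simp [m, fourier_apply, AddCircle.toCircle_nsmul]
  have hcs : Summable fun α => c α • UnitAddTorus.mFourier (m α) :=
    Summable.of_norm (by simpa only [norm_smul, UnitAddTorus.mFourier_norm, mul_one, hc] using hs)
  have hM0 : 0 ≤ M := (norm_nonneg _).trans (hM (fun _ => r) fun _ => by simp [abs_of_nonneg hr])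
  rw [← hc]
  refine (norm_coeff_le_norm_tsum_mFourier hm (by simpa only [hc] using hs) β).trans ?_
  refine (ContinuousMap.norm_le _ hM0).2 fun t => ?_
  rw [← ContinuousMap.tsum_apply hcs]
  simp only [ContinuousMap.smul_apply, smul_eq_mul, hterm]
  exact hM _ fun j => by rw [norm_mul, fourier_apply, Circle.norm_coe]; simp [abs_of_nonneg hr]

theorem RapidDecay.coeff_unique {b c : (ι → ℕ) → ℂ} (hb : RapidDecay b) (hc : RapidDecay c)
    (h : ∀ z : ι → ℂ, ∑' α, b α * ∏ j, z j ^ α j = ∑' α, c α * ∏ j, z j ^ α j) : b = c := by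
  ext β
  have := norm_coeff_mul_pow_le zero_le_one ((hb.sub hc) 1 zero_le_one) (M := 0) (fun z _ => by
    simp only [Pi.sub_apply, sub_mul]
    rw [(hb.summable_mul_prod_pow z).tsum_sub (hc.summable_mul_prod_pow z), h z, sub_self,
      norm_zero]) β
  simpa [sub_eq_zero] using this

end MultiIndexSeries

section HermiteFunctions

theorem iteratedDeriv_cexp_mul_sub_sq (x : ℂ) (k : ℕ) :
    iteratedDeriv k (fun w : ℂ => Complex.exp (x * w - w ^ 2 / 2)) =
      fun w => Polynomial.aeval (x - w) (Polynomial.hermite k) *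
        Complex.exp (x * w - w ^ 2 / 2) := by
  induction k with
  | zero => simp
  | succ k ih =>
    ext w
    have hexp : HasDerivAt (fun w : ℂ => Complex.exp (x * w - w ^ 2 / 2))
        (Complex.exp (x * w - w ^ 2 / 2) * (x - w)) w := by
      convert! (((hasDerivAt_id w).const_mul x).sub
        (((hasDerivAt_id w).pow 2).div_const 2)).cexp using 1
      simp
    have hpoly : HasDerivAt (fun w : ℂ => Polynomial.aeval (x - w) (Polynomial.hermite k))
        (-Polynomial.aeval (x - w) (Polynomial.derivative (Polynomial.hermite k))) w := by
      convert! (Polynomial.hasDerivAt_aeval (Polynomial.hermite k) (x - w)).comp w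
        ((hasDerivAt_id w).const_sub x) using 1
      simp
    rw [iteratedDeriv_succ, ih, (hpoly.fun_mul hexp).deriv, Polynomial.hermite_succ]
    simp only [map_sub, map_mul, Polynomial.aeval_X]
    ring

theorem aeval_hermite_eq_iteratedDeriv (x : ℂ) (k : ℕ) :
    Polynomial.aeval x (Polynomial.hermite k) =
      iteratedDeriv k (fun w : ℂ => Complex.exp (x * w - w ^ 2 / 2)) 0 := by
  simp [iteratedDeriv_cexp_mul_sub_sq]

theorem hasSum_hermite_generating (x w : ℂ) :
    HasSum (fun k : ℕ => w ^ k / k.factorial * Polynomial.aeval x (Polynomial.hermite k))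
      (Complex.exp (x * w - w ^ 2 / 2)) := by
  have hd : Differentiable ℂ fun w : ℂ => Complex.exp (x * w - w ^ 2 / 2) := by fun_prop
  refine (Complex.hasSum_taylorSeries_of_entire hd 0 w).congr_fun fun k => ?_
  rw [aeval_hermite_eq_iteratedDeriv, sub_zero, smul_eq_mul]
  ring

theorem norm_aeval_hermite_le {R : ℝ} (hR : 0 < R) (x : ℂ) (k : ℕ) :
    ‖Polynomial.aeval x (Polynomial.hermite k)‖ ≤
      k.factorial * Real.exp (‖x‖ * R + R ^ 2 / 2) / R ^ k := by
  rw [aeval_hermite_eq_iteratedDeriv]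
  have hd : Differentiable ℂ fun w : ℂ => Complex.exp (x * w - w ^ 2 / 2) := by fun_prop
  refine Complex.norm_iteratedDeriv_le_of_forall_mem_sphere_norm_le k hR hd.diffContOnCl
    fun w hw => ?_
  rw [mem_sphere_zero_iff_norm] at hw
  calc ‖Complex.exp (x * w - w ^ 2 / 2)‖ ≤ Real.exp ‖x * w - w ^ 2 / 2‖ :=
        Complex.norm_exp_le_exp_norm _
    _ ≤ Real.exp (‖x‖ * R + R ^ 2 / 2) := by
        gcongr
        refine (norm_sub_le _ _).trans_eq ?_
        simp [hw]

/-- The polynomial factor of the `k`-th Hermite function, as a function on `ℂ`. -/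
def hermitePoly (k : ℕ) (z : ℂ) : ℂ :=
  ((√(k.factorial * √Real.pi))⁻¹ : ℝ) * Polynomial.aeval (√2 * z) (Polynomial.hermite k)

theorem hermiteFun_eq (k : ℕ) (x : ℝ) :
    (hermiteFun k x : ℂ) = hermitePoly k x * Complex.exp (-(x : ℂ) ^ 2 / 2) := by
  have hcast : ((Polynomial.aeval (√2 * x) (Polynomial.hermite k) : ℝ) : ℂ) =
      Polynomial.aeval ((√2 : ℂ) * x) (Polynomial.hermite k) := by
    rw [← Complex.ofReal_mul]
    exact (Polynomial.aeval_algebraMap_apply ℂ (√2 * x) (Polynomial.hermite k)).symm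
  simp only [hermiteFun, hermitePoly]
  push_cast
  rw [hcast]

theorem differentiable_hermitePoly (k : ℕ) : Differentiable ℂ (hermitePoly k) := by
  have h : Differentiable ℂ fun z : ℂ => Polynomial.aeval z (Polynomial.hermite k) :=
    fun z => (Polynomial.hasDerivAt_aeval (Polynomial.hermite k) z).differentiableAt
  exact (h.comp (differentiable_id.const_mul (√2 : ℂ))).const_mul _

theorem sqrt_factorial_le_sqrt_pow (k : ℕ) : √(k.factorial : ℝ) ≤ √(k : ℝ) ^ k := by
  refine Real.sqrt_le_iff.2 ⟨by positivity, ?_⟩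
  rw [pow_right_comm, Real.sq_sqrt k.cast_nonneg]
  exact_mod_cast k.factorial_le_pow

theorem norm_hermitePoly_le (k : ℕ) (z : ℂ) :
    ‖hermitePoly k z‖ ≤ Real.exp (√2 * ‖z‖ * √k + k / 2) := by
  have hpi : 1 ≤ √Real.pi := Real.one_le_sqrt.2 (by linarith [Real.pi_gt_three])
  have hsplit : ‖hermitePoly k z‖ ≤
      (√(k.factorial : ℝ))⁻¹ * ‖Polynomial.aeval (√2 * z) (Polynomial.hermite k)‖ := by
    rw [hermitePoly, norm_mul, Complex.norm_real, Real.norm_of_nonneg (by positivity)]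
    gcongr
    exact le_mul_of_one_le_right (by positivity) hpi
  rcases k.eq_zero_or_pos with rfl | hk
  · simpa using hsplit
  have hsk : 0 < √(k : ℝ) := Real.sqrt_pos.2 (by exact_mod_cast hk)
  have : 0 < √(k.factorial : ℝ) := Real.sqrt_pos.2 (by exact_mod_cast k.factorial_pos)
  -- Cauchy's estimate on the circle of radius `√k`
  have hcauchy := norm_aeval_hermite_le hsk (√2 * z) k
  rw [norm_mul, Complex.norm_real, Real.norm_of_nonneg (by positivity),
    Real.sq_sqrt k.cast_nonneg] at hcauchy
  refine hsplit.trans ((mul_le_mul_of_nonneg_left hcauchy (by positivity)).trans ?_)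
  set e := Real.exp (√2 * ‖z‖ * √k + k / 2)
  calc (√(k.factorial : ℝ))⁻¹ * (k.factorial * e / √k ^ k)
      = √(k.factorial : ℝ) / √k ^ k * e := by
        nth_rewrite 2 [← Real.mul_self_sqrt (Nat.cast_nonneg k.factorial)]
        field_simp
    _ ≤ 1 * e := by
        gcongr
        exact div_le_one_of_le₀ (sqrt_factorial_le_sqrt_pow k) (by positivity)
    _ = e := one_mul e

theorem norm_hermitePoly_le_gaussian {ε : ℝ} (hε : 0 < ε) (k : ℕ) (z : ℂ) :
    ‖hermitePoly k z‖ ≤ Real.exp (1 / 2 + 1 / (2 * ε)) ^ k * Real.exp (ε * ‖z‖ ^ 2) := by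
  refine (norm_hermitePoly_le k z).trans ?_
  rw [← Real.exp_nat_mul, ← Real.exp_add, Real.exp_le_exp]
  -- AM-GM for `√2 ‖z‖ √k`
  have hsq : (√2 * ε * ‖z‖ - √k) ^ 2 =
      2 * ε * (k * (1 / (2 * ε)) + ε * ‖z‖ ^ 2 - √2 * ‖z‖ * √k) := by
    field_simp
    linear_combination (ε ^ 2 * ‖z‖ ^ 2) * Real.sq_sqrt zero_le_two + Real.sq_sqrt k.cast_nonneg
  have := nonneg_of_mul_nonneg_right (hsq ▸ sq_nonneg _) (by positivity)
  linarith

variable {n : ℕ}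

@[simp]
theorem realToComplex_apply (x : EuclideanSpace ℝ (Fin n)) (j : Fin n) :
    realToComplex x j = x j := rfl

theorem norm_realToComplex (x : EuclideanSpace ℝ (Fin n)) : ‖realToComplex x‖ = ‖x‖ := by
  simp [EuclideanSpace.norm_eq]

theorem continuous_realToComplex :
    Continuous (realToComplex : EuclideanSpace ℝ (Fin n) → EuclideanSpace ℂ (Fin n)) := by
  unfold realToComplex
  fun_prop

theorem sum_ofReal_sq (x : EuclideanSpace ℝ (Fin n)) :
    ∑ j, (x j : ℂ) ^ 2 = (‖x‖ : ℂ) ^ 2 := by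
  rw [← Complex.ofReal_pow, EuclideanSpace.real_norm_sq_eq]
  push_cast
  rfl

/-- The polynomial factor of the Hermite function `Φ_α`, as a function on `ℂⁿ`. -/
def hermitePolyMulti (α : Fin n → ℕ) (z : EuclideanSpace ℂ (Fin n)) : ℂ :=
  ∏ j, hermitePoly (α j) (z j)

theorem differentiable_hermitePolyMulti (α : Fin n → ℕ) :
    Differentiable ℂ (hermitePolyMulti α) := by
  have h (j : Fin n) : Differentiable ℂ fun z : EuclideanSpace ℂ (Fin n) =>
      hermitePoly (α j) (z j) :=
    (differentiable_hermitePoly _).comp (by fun_prop)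
  unfold hermitePolyMulti
  fun_prop

theorem norm_hermitePolyMulti_le {ε : ℝ} (hε : 0 < ε) (α : Fin n → ℕ)
    (z : EuclideanSpace ℂ (Fin n)) :
    ‖hermitePolyMulti α z‖ ≤
      Real.exp (1 / 2 + 1 / (2 * ε)) ^ multiDegree α * Real.exp (ε * ‖z‖ ^ 2) := by
  rw [hermitePolyMulti, norm_prod, EuclideanSpace.norm_sq_eq, Finset.mul_sum, Real.exp_sum,
    ← prod_pow_eq_pow_multiDegree, ← Finset.prod_mul_distrib]
  exact Finset.prod_le_prod (fun _ _ => norm_nonneg _)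
    fun j _ => norm_hermitePoly_le_gaussian hε _ _

theorem hermiteFunction_eq (α : Fin n → ℕ) (x : EuclideanSpace ℝ (Fin n)) :
    (hermiteFunction α x : ℂ) =
      hermitePolyMulti α (realToComplex x) * Complex.exp (-(‖x‖ : ℂ) ^ 2 / 2) := by
  rw [hermiteFunction, hermitePolyMulti, Complex.ofReal_prod]
  simp only [hermiteFun_eq, Finset.prod_mul_distrib, realToComplex_apply]
  rw [← Complex.exp_sum, ← Finset.sum_div, Finset.sum_neg_distrib, sum_ofReal_sq]

theorem continuous_hermiteFunction (α : Fin n → ℕ) :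
    Continuous fun x : EuclideanSpace ℝ (Fin n) => (hermiteFunction α x : ℂ) := by
  simp_rw [hermiteFunction_eq]
  exact ((differentiable_hermitePolyMulti α).continuous.comp continuous_realToComplex).mul
    (by fun_prop)

theorem norm_cexp_neg_norm_sq_div_two {V : Type*} [SeminormedAddCommGroup V] (x : V) :
    ‖Complex.exp (-(‖x‖ : ℂ) ^ 2 / 2)‖ = Real.exp (-‖x‖ ^ 2 / 2) := by
  rw [Complex.norm_exp]
  norm_cast

theorem norm_hermiteFunction_le {ε : ℝ} (hε : 0 < ε) (α : Fin n → ℕ)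
    (x : EuclideanSpace ℝ (Fin n)) :
    ‖(hermiteFunction α x : ℂ)‖ ≤
      Real.exp (1 / 2 + 1 / (2 * ε)) ^ multiDegree α * Real.exp ((ε - 1 / 2) * ‖x‖ ^ 2) := by
  calc ‖(hermiteFunction α x : ℂ)‖
      = ‖hermitePolyMulti α (realToComplex x)‖ * Real.exp (-‖x‖ ^ 2 / 2) := by
        rw [hermiteFunction_eq, norm_mul, norm_cexp_neg_norm_sq_div_two]
    _ ≤ Real.exp (1 / 2 + 1 / (2 * ε)) ^ multiDegree α * Real.exp (ε * ‖x‖ ^ 2) *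
          Real.exp (-‖x‖ ^ 2 / 2) := by
        gcongr
        exact (norm_hermitePolyMulti_le hε α _).trans_eq (by rw [norm_realToComplex])
    _ = _ := by
        rw [mul_assoc, ← Real.exp_add]
        ring_nf

end HermiteFunctions

section GaussianIntegrability

variable {V : Type*} [NormedAddCommGroup V] [InnerProductSpace ℝ V] [FiniteDimensional ℝ V]
  [MeasurableSpace V] [BorelSpace V]

theorem integrable_exp_neg_mul_norm_sq {b : ℝ} (hb : 0 < b) :
    Integrable fun x : V => Real.exp (-b * ‖x‖ ^ 2) := by
  have h := (GaussianFourier.integrable_cexp_neg_mul_sq_norm_add (V := V) (b := (b : ℂ))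
    (by simpa) 0 0).norm
  refine h.congr (Eventually.of_forall fun x => ?_)
  simp [Complex.norm_exp, ← Complex.ofReal_pow]

theorem memLp_exp_neg_mul_norm_sq {b : ℝ} (hb : 0 < b) (p : ENNReal) :
    MemLp (fun x : V => Real.exp (-b * ‖x‖ ^ 2)) p := by
  have hcont : Continuous fun x : V => Real.exp (-b * ‖x‖ ^ 2) := by fun_prop
  have hm := hcont.aestronglyMeasurable (μ := volume)
  rcases eq_or_ne p 0 with rfl | hp0
  · exact memLp_zero_iff_aestronglyMeasurable.2 hm
  rcases eq_or_ne p ⊤ with rfl | hp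
  · refine memLp_top_of_bound hm 1 (Eventually.of_forall fun x => ?_)
    rw [Real.norm_of_nonneg (Real.exp_pos _).le, Real.exp_le_one_iff, neg_mul]
    exact neg_nonpos.2 (by positivity)
  rw [← integrable_norm_rpow_iff hm hp0 hp]
  have hpos := ENNReal.toReal_pos hp0 hp
  refine (integrable_exp_neg_mul_norm_sq (mul_pos hb hpos)).congr (Eventually.of_forall fun x => ?_)
  simp only [Real.norm_of_nonneg (Real.exp_pos _).le, ← Real.exp_mul]
  ring_nf

theorem memLp_of_norm_le_gaussian {f : V → ℂ} (hf : Continuous f) {b C : ℝ} (hb : 0 < b)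
    (h : ∀ x, ‖f x‖ ≤ C * Real.exp (-b * ‖x‖ ^ 2)) (p : ENNReal) : MemLp f p :=
  (memLp_exp_neg_mul_norm_sq hb p).of_le_mul hf.aestronglyMeasurable
    (Eventually.of_forall fun x => by
      simpa only [Real.norm_of_nonneg (Real.exp_pos _).le] using h x)

/-- Integrability against a Gaussian that dominates every Hermite function: the functions with
this property have Hermite coefficients and a Bargmann transform. -/
def GaussIntegrable (f : V → ℂ) : Prop :=
  Integrable fun x => f x * (Real.exp (-(1 / 4) * ‖x‖ ^ 2) : ℂ)

theorem gaussIntegrable_of_memLp {f : V → ℂ} {p : ENNReal} (hp : 1 ≤ p) (hf : MemLp f p) :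
    GaussIntegrable f := by
  have := ENNReal.HolderConjugate.conjExponent hp
  exact hf.integrable_mul (q := p.conjExponent)
    (memLp_exp_neg_mul_norm_sq (by norm_num : (0 : ℝ) < 1 / 4) _).ofReal

namespace GaussIntegrable

variable {f g : V → ℂ}

theorem sub (hf : GaussIntegrable f) (hg : GaussIntegrable g) : GaussIntegrable (f - g) := by
  simpa only [GaussIntegrable, Pi.sub_def, sub_mul] using Integrable.sub hf hg

theorem integrable_mul (hf : GaussIntegrable f) (hg : Continuous g) {D : ℝ}
    (h : ∀ x, ‖g x‖ ≤ D * Real.exp (-(1 / 4) * ‖x‖ ^ 2)) : Integrable fun x => f x * g x := by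
  have hbdd : ∀ x, ‖(Real.exp (1 / 4 * ‖x‖ ^ 2) : ℂ) * g x‖ ≤ D := fun x => by
    rw [norm_mul, Complex.norm_real, Real.norm_of_nonneg (Real.exp_pos _).le, mul_comm,
      ← le_div_iff₀ (Real.exp_pos _), div_eq_mul_inv, ← Real.exp_neg, ← neg_mul]
    exact h x
  have hcont : Continuous fun x => (Real.exp (1 / 4 * ‖x‖ ^ 2) : ℂ) * g x := by fun_prop
  refine (Integrable.mul_bdd (c := D) hf hcont.aestronglyMeasurable
    (Eventually.of_forall hbdd)).congr (Eventually.of_forall fun x => ?_)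
  have : (Real.exp (-(1 / 4) * ‖x‖ ^ 2) : ℂ) * Real.exp (1 / 4 * ‖x‖ ^ 2) = 1 := by
    rw [← Complex.ofReal_mul, ← Real.exp_add]
    simp
  linear_combination (f x * g x) * this

theorem integral_norm_mul_le (hf : GaussIntegrable f) (hg : Continuous g) {D : ℝ}
    (h : ∀ x, ‖g x‖ ≤ D * Real.exp (-(1 / 4) * ‖x‖ ^ 2)) :
    ∫ x, ‖f x * g x‖ ≤ (∫ x, ‖f x * (Real.exp (-(1 / 4) * ‖x‖ ^ 2) : ℂ)‖) * D := by
  rw [← integral_mul_const]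
  refine integral_mono (hf.integrable_mul hg h).norm (Integrable.norm hf |>.mul_const D) fun x => ?_
  rw [norm_mul, norm_mul, Complex.norm_real, Real.norm_of_nonneg (Real.exp_pos _).le, mul_assoc,
    mul_comm _ D]
  exact mul_le_mul_of_nonneg_left (h x) (norm_nonneg _)

end GaussIntegrable

end GaussianIntegrability

section HermiteSeries

variable {n : ℕ} {c : (Fin n → ℕ) → ℂ} {f g : EuclideanSpace ℝ (Fin n) → ℂ}

theorem norm_hermiteFunction_le_gaussian (α : Fin n → ℕ) (x : EuclideanSpace ℝ (Fin n)) :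
    ‖(hermiteFunction α x : ℂ)‖ ≤
      Real.exp (5 / 2) ^ multiDegree α * Real.exp (-(1 / 4) * ‖x‖ ^ 2) := by
  convert! norm_hermiteFunction_le (by norm_num : (0 : ℝ) < 1 / 4) α x using 4 <;> norm_num

theorem memLp_hermiteFunction (α : Fin n → ℕ) (p : ENNReal) :
    MemLp (fun x : EuclideanSpace ℝ (Fin n) => (hermiteFunction α x : ℂ)) p :=
  memLp_of_norm_le_gaussian (continuous_hermiteFunction α) (by norm_num)
    (norm_hermiteFunction_le_gaussian α) p

namespace GaussIntegrable

theorem integrable_mul_hermiteFunction (hf : GaussIntegrable f) (α : Fin n → ℕ) :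
    Integrable fun x => f x * (hermiteFunction α x : ℂ) :=
  hf.integrable_mul (continuous_hermiteFunction α) (norm_hermiteFunction_le_gaussian α)

theorem integral_norm_mul_hermiteFunction_le (hf : GaussIntegrable f) (α : Fin n → ℕ) :
    ∫ x, ‖f x * (hermiteFunction α x : ℂ)‖ ≤
      (∫ x, ‖f x * (Real.exp (-(1 / 4) * ‖x‖ ^ 2) : ℂ)‖) * Real.exp (5 / 2) ^ multiDegree α :=
  hf.integral_norm_mul_le (continuous_hermiteFunction α) (norm_hermiteFunction_le_gaussian α)

theorem norm_hermiteCoeff_le (hf : GaussIntegrable f) (α : Fin n → ℕ) :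
    ‖hermiteCoeff f α‖ ≤
      (∫ x, ‖f x * (Real.exp (-(1 / 4) * ‖x‖ ^ 2) : ℂ)‖) * Real.exp (5 / 2) ^ multiDegree α :=
  (norm_integral_le_integral_norm _).trans (hf.integral_norm_mul_hermiteFunction_le α)

theorem hermiteCoeff_sub (hf : GaussIntegrable f) (hg : GaussIntegrable g) :
    hermiteCoeff (f - g) = hermiteCoeff f - hermiteCoeff g := by
  ext α
  simp only [hermiteCoeff, Pi.sub_apply, sub_mul]
  exact integral_sub (hf.integrable_mul_hermiteFunction α) (hg.integrable_mul_hermiteFunction α)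

end GaussIntegrable

/-- The sum on `ℝⁿ` of the Hermite series with coefficients `c`. -/
def hermiteSeries (c : (Fin n → ℕ) → ℂ) (x : EuclideanSpace ℝ (Fin n)) : ℂ :=
  ∑' α, c α * hermiteFunction α x

/-- The entire function that remains of the Hermite series with coefficients `c` when the Gaussian
factor is removed. -/
def hermitePolySeries (c : (Fin n → ℕ) → ℂ) (z : EuclideanSpace ℂ (Fin n)) : ℂ :=
  ∑' α, c α * hermitePolyMulti α z

/-- The entire extension to `ℂⁿ` of the Hermite series with coefficients `c`. -/
def hermiteEntire (c : (Fin n → ℕ) → ℂ) (z : EuclideanSpace ℂ (Fin n)) : ℂ :=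
  hermitePolySeries c z * Complex.exp (-(∑ j, z j ^ 2) / 2)

theorem realRestriction_hermiteEntire (c : (Fin n → ℕ) → ℂ) :
    realRestriction (hermiteEntire c) = hermiteSeries c := by
  ext x
  simp only [realRestriction, hermiteEntire, hermitePolySeries, hermiteSeries, realToComplex_apply,
    sum_ofReal_sq, ← tsum_mul_right, hermiteFunction_eq, mul_assoc]

theorem mulExpHalfSq_hermiteEntire (c : (Fin n → ℕ) → ℂ) :
    mulExpHalfSq (hermiteEntire c) = hermitePolySeries c := by
  ext z
  rw [mulExpHalfSq, hermiteEntire, mul_assoc, ← Complex.exp_add]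
  ring_nf
  rw [Complex.exp_zero, mul_one]

namespace RapidDecay

theorem differentiable_hermitePolySeries (hc : RapidDecay c) :
    Differentiable ℂ (hermitePolySeries c) := by
  refine hc.differentiable_tsum differentiable_hermitePolyMulti fun R =>
    ⟨Real.exp (1 * R ^ 2), Real.exp (1 / 2 + 1 / (2 * 1)), (Real.exp_pos _).le, fun α z hz =>
      (norm_hermitePolyMulti_le one_pos α z).trans ?_⟩
  rw [mul_comm]
  gcongr

theorem isEntireOrderTwoMinimalType (hc : RapidDecay c) :
    IsEntireOrderTwoMinimalType (hermitePolySeries c) := by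
  refine ⟨hc.differentiable_hermitePolySeries, fun ε hε => ⟨_, fun z =>
    tsum_of_norm_bounded ((hc _ (Real.exp_pos (1 / 2 + 1 / (2 * ε))).le).hasSum.mul_right _)
      fun α => ?_⟩⟩
  rw [norm_mul, mul_assoc]
  gcongr
  exact norm_hermitePolyMulti_le hε α z

theorem differentiable_hermiteEntire (hc : RapidDecay c) : Differentiable ℂ (hermiteEntire c) :=
  hc.differentiable_hermitePolySeries.mul (by fun_prop)

theorem continuous_hermiteSeries (hc : RapidDecay c) : Continuous (hermiteSeries c) := by
  rw [← realRestriction_hermiteEntire]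
  exact hc.differentiable_hermiteEntire.continuous.comp continuous_realToComplex

theorem norm_hermiteSeries_le (hc : RapidDecay c) {ε : ℝ} (hε : 0 < ε)
    (x : EuclideanSpace ℝ (Fin n)) :
    ‖hermiteSeries c x‖ ≤ (∑' α, ‖c α‖ * Real.exp (1 / 2 + 1 / (2 * ε)) ^ multiDegree α) *
      Real.exp ((ε - 1 / 2) * ‖x‖ ^ 2) := by
  refine tsum_of_norm_bounded ((hc _ (Real.exp_pos _).le).hasSum.mul_right _) fun α => ?_
  rw [norm_mul, mul_assoc]
  gcongr
  exact norm_hermiteFunction_le hε α x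

theorem memLp_hermiteSeries (hc : RapidDecay c) (p : ENNReal) : MemLp (hermiteSeries c) p :=
  memLp_of_norm_le_gaussian hc.continuous_hermiteSeries (b := -(1 / 4 - 1 / 2)) (by norm_num)
    (fun x => by
      rw [neg_neg]
      exact hc.norm_hermiteSeries_le (by norm_num : (0 : ℝ) < 1 / 4) x) p

theorem gaussIntegrable_hermiteSeries (hc : RapidDecay c) : GaussIntegrable (hermiteSeries c) :=
  gaussIntegrable_of_memLp le_rfl (hc.memLp_hermiteSeries 1)

theorem integral_mul_hermiteSeries (hc : RapidDecay c) (hf : GaussIntegrable f) :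
    ∫ x, f x * hermiteSeries c x = ∑' α, c α * hermiteCoeff f α := by
  have hnorm : Summable fun α => ∫ x, ‖c α * (f x * (hermiteFunction α x : ℂ))‖ := by
    refine (hc.summable_norm_mul (Real.exp_pos (5 / 2)).le
      (h := fun α => ((∫ x, ‖f x * (hermiteFunction α x : ℂ)‖ : ℝ) : ℂ))
      (D := ∫ x, ‖f x * (Real.exp (-(1 / 4) * ‖x‖ ^ 2) : ℂ)‖) fun α => ?_).congr fun α => ?_
    · rw [Complex.norm_real, Real.norm_of_nonneg (integral_nonneg fun _ => norm_nonneg _)]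
      exact hf.integral_norm_mul_hermiteFunction_le α
    · simp only [norm_mul (c α), integral_const_mul, Complex.norm_real,
        Real.norm_of_nonneg (integral_nonneg fun _ => norm_nonneg _)]
  have hswap := integral_tsum_of_summable_integral_norm
    (fun α => (hf.integrable_mul_hermiteFunction α).const_mul (c α)) hnorm
  simp only [integral_const_mul] at hswap
  simp only [hermiteSeries, hermiteCoeff, hswap, ← tsum_mul_left, mul_left_comm (f _)]

end RapidDecay

end HermiteSeries

section BargmannTransform

variable {n : ℕ} {f : EuclideanSpace ℝ (Fin n) → ℂ}

/-- The kernel `π^(-n/4) exp(-z²/2 + √2 x·z - |x|²/2)` of the Bargmann transform. -/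
def bargmannKernel (z : Fin n → ℂ) (x : EuclideanSpace ℝ (Fin n)) : ℂ :=
  (((√√Real.pi)⁻¹ ^ n : ℝ) : ℂ) *
    Complex.exp (-(∑ j, z j ^ 2) / 2 + √2 * ∑ j, (x j : ℂ) * z j - (‖x‖ : ℂ) ^ 2 / 2)

/-- The Bargmann transform, an entire function of `z ∈ ℂⁿ` whose Taylor coefficients are the
Hermite coefficients of `f` up to the weights `fockWeight`. -/
def bargmann (f : EuclideanSpace ℝ (Fin n) → ℂ) (z : Fin n → ℂ) : ℂ :=
  ∫ x, f x * bargmannKernel z x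

/-- The constants `1 / √(α!)` that normalize the monomials `z^α` in the Fock space. -/
def fockWeight (α : Fin n → ℕ) : ℝ := ∏ j, (√((α j).factorial : ℝ))⁻¹

theorem fockWeight_pos (α : Fin n → ℕ) : 0 < fockWeight α := by
  unfold fockWeight
  positivity

theorem norm_fockWeight (α : Fin n → ℕ) : ‖(fockWeight α : ℂ)‖ = fockWeight α := by
  rw [Complex.norm_real, Real.norm_of_nonneg (fockWeight_pos α).le]

theorem inv_sqrt_factorial_mul_pow_le (T : ℝ) (k : ℕ) :
    (√(k.factorial : ℝ))⁻¹ * T ^ k ≤ √(Real.exp (T ^ 2)) := by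
  refine Real.le_sqrt_of_sq_le ?_
  rw [mul_pow, inv_pow, Real.sq_sqrt (by positivity), pow_right_comm, inv_mul_eq_div]
  exact Real.pow_div_factorial_le_exp _ (by positivity) k

theorem rapidDecay_fockWeight : RapidDecay fun α : Fin n → ℕ => (fockWeight α : ℂ) := by
  refine RapidDecay.of_bound fun T hT => ⟨√(Real.exp (T ^ 2)) ^ n, fun α => ?_⟩
  rw [norm_fockWeight, fockWeight, ← prod_pow_eq_pow_multiDegree, ← Finset.prod_mul_distrib]
  exact (Finset.prod_le_prod (fun _ _ => by positivity)
    fun j _ => inv_sqrt_factorial_mul_pow_le T (α j)).trans_eq (by simp)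

theorem hasSum_hermiteFun_bargmann (z : ℂ) (x : ℝ) :
    HasSum (fun k : ℕ => ((√(k.factorial : ℝ))⁻¹ : ℝ) * z ^ k * (hermiteFun k x : ℂ))
      (((√√Real.pi)⁻¹ : ℝ) * Complex.exp (-z ^ 2 / 2 + √2 * (x * z) - (x : ℂ) ^ 2 / 2)) := by
  have hsum := ((hasSum_hermite_generating (√2 * x) z).mul_right
    (Complex.exp (-(x : ℂ) ^ 2 / 2))).mul_left (((√√Real.pi)⁻¹ : ℝ) : ℂ)
  rw [← Complex.exp_add] at hsum
  convert! hsum using 1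
  · ext k
    have hnorm : (((√(k.factorial : ℝ))⁻¹ : ℝ) : ℂ) * ((√(k.factorial * √Real.pi))⁻¹ : ℝ) =
        ((√√Real.pi)⁻¹ : ℝ) * (k.factorial : ℂ)⁻¹ := by
      have hk : (0 : ℝ) ≤ k.factorial := k.factorial.cast_nonneg
      rw [← Complex.ofReal_mul, Real.sqrt_mul hk, mul_inv, ← mul_assoc, ← mul_inv,
        Real.mul_self_sqrt hk, mul_comm]
      push_cast
      rfl
    rw [hermiteFun_eq, hermitePoly]
    linear_combination (z ^ k * (Polynomial.aeval ((√2 : ℂ) * x) (Polynomial.hermite k)) *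
      Complex.exp (-(x : ℂ) ^ 2 / 2)) * hnorm
  · ring_nf

theorem bargmannKernel_eq_hermiteSeries (z : Fin n → ℂ) :
    bargmannKernel z = hermiteSeries fun α => (fockWeight α : ℂ) * ∏ j, z j ^ α j := by
  ext x
  have hprod : bargmannKernel z x = ∏ j, ((√√Real.pi)⁻¹ : ℝ) *
      Complex.exp (-z j ^ 2 / 2 + √2 * (x j * z j) - (x j : ℂ) ^ 2 / 2) := by
    rw [bargmannKernel, ← sum_ofReal_sq, Finset.prod_mul_distrib, ← Complex.exp_sum,
      Finset.sum_sub_distrib, Finset.sum_add_distrib, ← Finset.sum_div, ← Finset.sum_div,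
      ← Finset.mul_sum, Finset.sum_neg_distrib]
    simp
  have hsum (j : Fin n) := hasSum_hermiteFun_bargmann (z j) (x j)
  rw [hprod, ← (hasSum_prod_pi hsum fun j => (hsum j).summable.norm).1.tsum_eq, hermiteSeries]
  simp only [fockWeight, hermiteFunction, Finset.prod_mul_distrib, Complex.ofReal_prod]

theorem rapidDecay_fockWeight_mul_prod_pow (z : Fin n → ℂ) :
    RapidDecay fun α => (fockWeight α : ℂ) * ∏ j, z j ^ α j := by
  refine rapidDecay_fockWeight.of_norm_le (A := 1) (norm_nonneg z) fun α => ?_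
  rw [one_mul, norm_mul]
  exact mul_le_mul_of_nonneg_left (norm_prod_pow_le (norm_le_pi_norm z) α) (norm_nonneg _)

namespace GaussIntegrable

theorem bargmann_eq (hf : GaussIntegrable f) (z : Fin n → ℂ) :
    bargmann f z = ∑' α, fockWeight α * hermiteCoeff f α * ∏ j, z j ^ α j := by
  rw [bargmann, bargmannKernel_eq_hermiteSeries,
    (rapidDecay_fockWeight_mul_prod_pow z).integral_mul_hermiteSeries hf]
  simp only [mul_right_comm]

theorem rapidDecay_fockWeight_mul_hermiteCoeff (hf : GaussIntegrable f) :
    RapidDecay fun α => fockWeight α * hermiteCoeff f α := by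
  refine rapidDecay_fockWeight.of_norm_le
    (A := ∫ x, ‖f x * (Real.exp (-(1 / 4) * ‖x‖ ^ 2) : ℂ)‖) (Real.exp_pos (5 / 2)).le fun α => ?_
  rw [norm_mul, mul_left_comm]
  exact mul_le_mul_of_nonneg_left (hf.norm_hermiteCoeff_le α) (norm_nonneg _)

theorem differentiable_bargmann (hf : GaussIntegrable f) : Differentiable ℂ (bargmann f) := by
  have hb := hf.rapidDecay_fockWeight_mul_hermiteCoeff
  rw [funext hf.bargmann_eq]
  refine hb.differentiable_tsum (fun α => by fun_prop) fun R =>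
    ⟨1, |R|, abs_nonneg R, fun α z hz => ?_⟩
  rw [one_mul]
  exact norm_prod_pow_le (fun j => (norm_le_pi_norm z j).trans (hz.trans (le_abs_self R))) α

theorem hermiteCoeff_eq (hf : GaussIntegrable f) {c : (Fin n → ℕ) → ℂ}
    (hc : RapidDecay fun α => fockWeight α * c α)
    (h : ∀ z, bargmann f z = ∑' α, fockWeight α * c α * ∏ j, z j ^ α j) :
    hermiteCoeff f = c := by
  have huniq := hf.rapidDecay_fockWeight_mul_hermiteCoeff.coeff_unique hc fun z =>
    (hf.bargmann_eq z).symm.trans (h z)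
  exact funext fun α => mul_left_cancel₀
    (Complex.ofReal_ne_zero.2 (fockWeight_pos α).ne') (congrFun huniq α)

end GaussIntegrable

theorem integral_cexp_neg_mul_norm_sq_add_sum {b : ℝ} (hb : 0 < b) (c : Fin n → ℂ) :
    ∫ x : EuclideanSpace ℝ (Fin n), Complex.exp (-b * (‖x‖ : ℂ) ^ 2 + ∑ j, c j * x j) =
      ((√(Real.pi / b) ^ n : ℝ) : ℂ) * Complex.exp ((∑ j, c j ^ 2) / (4 * b)) := by
  simp only [← sum_ofReal_sq]
  rw [← (PiLp.volume_preserving_toLp (Fin n)).integral_comp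
    (MeasurableEquiv.toLp 2 _).measurableEmbedding]
  refine (GaussianFourier.integral_cexp_neg_mul_sum_add (by simpa) c).trans ?_
  congr 1
  rw [Real.sqrt_eq_rpow, ← Real.rpow_mul_natCast (by positivity),
    Complex.ofReal_cpow (by positivity)]
  push_cast
  rw [Fintype.card_fin, one_div_mul_eq_div]

theorem bargmann_bargmannKernel (z w : Fin n → ℂ) :
    bargmann (bargmannKernel w) z = Complex.exp (∑ j, w j * z j) := by
  have hprod (x : EuclideanSpace ℝ (Fin n)) : bargmannKernel w x * bargmannKernel z x =
      ((√Real.pi ^ n)⁻¹ : ℝ) * Complex.exp (-(∑ j, w j ^ 2 + ∑ j, z j ^ 2) / 2) *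
        Complex.exp (-(1 : ℝ) * (‖x‖ : ℂ) ^ 2 + ∑ j, √2 * (w j + z j) * x j) := by
    have hconst : (√√Real.pi)⁻¹ ^ n * (√√Real.pi)⁻¹ ^ n = (√Real.pi ^ n)⁻¹ := by
      rw [← mul_pow, ← mul_inv, Real.mul_self_sqrt (Real.sqrt_nonneg _), inv_pow]
    have hsum : ∑ j, √2 * (w j + z j) * (x j : ℂ) =
        √2 * ∑ j, (x j : ℂ) * w j + √2 * ∑ j, (x j : ℂ) * z j := by
      rw [← mul_add, ← Finset.sum_add_distrib, Finset.mul_sum]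
      exact Finset.sum_congr rfl fun j _ => by ring
    rw [bargmannKernel, bargmannKernel, mul_mul_mul_comm, ← Complex.ofReal_mul, hconst, mul_assoc,
      ← Complex.exp_add, ← Complex.exp_add, hsum]
    push_cast
    ring_nf
  have hexp : -(∑ j, w j ^ 2 + ∑ j, z j ^ 2) / 2 +
      (∑ j, (√2 * (w j + z j)) ^ 2) / (4 * (1 : ℝ)) = ∑ j, w j * z j := by
    have hsq : ((√2 : ℝ) : ℂ) ^ 2 = 2 := by norm_cast; simp
    rw [← Finset.sum_add_distrib, ← Finset.sum_neg_distrib, Finset.sum_div, Finset.sum_div,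
      ← Finset.sum_add_distrib]
    refine Finset.sum_congr rfl fun j _ => ?_
    push_cast
    linear_combination (w j + z j) ^ 2 / 4 * hsq
  simp only [bargmann, hprod, integral_const_mul]
  rw [integral_cexp_neg_mul_norm_sq_add_sum one_pos, div_one, mul_mul_mul_comm,
    ← Complex.exp_add, hexp, ← Complex.ofReal_mul, inv_mul_cancel₀ (by positivity),
    Complex.ofReal_one, one_mul]

theorem unitaryFourier_bargmannKernel (z : Fin n → ℂ) :
    unitaryFourier (bargmannKernel z) = bargmannKernel fun j => -Complex.I * z j := by
  ext ξ
  have hprod (x : EuclideanSpace ℝ (Fin n)) :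
      Complex.exp (-Complex.I * ((inner ℝ x ξ : ℝ) : ℂ)) * bargmannKernel z x =
      ((√√Real.pi)⁻¹ ^ n : ℝ) * Complex.exp (-(∑ j, z j ^ 2) / 2) *
        Complex.exp (-(1 / 2 : ℝ) * (‖x‖ : ℂ) ^ 2 +
          ∑ j, (√2 * z j - Complex.I * ξ j) * (x j : ℂ)) := by
    have hsum : ∑ j, (√2 * z j - Complex.I * ξ j) * (x j : ℂ) =
        √2 * ∑ j, (x j : ℂ) * z j - Complex.I * ((inner ℝ x ξ : ℝ) : ℂ) := by
      simp only [PiLp.inner_apply, RCLike.inner_apply, conj_trivial, Complex.ofReal_sum,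
        Complex.ofReal_mul, Finset.mul_sum, ← Finset.sum_sub_distrib]
      exact Finset.sum_congr rfl fun j _ => by ring
    rw [bargmannKernel, mul_left_comm, mul_assoc, ← Complex.exp_add, ← Complex.exp_add, hsum]
    push_cast
    ring_nf
  have hexp : -(∑ j, z j ^ 2) / 2 + (∑ j, (√2 * z j - Complex.I * ξ j) ^ 2) / (4 * (1 / 2 : ℝ)) =
      -(∑ j, (-Complex.I * z j) ^ 2) / 2 + √2 * ∑ j, (ξ j : ℂ) * (-Complex.I * z j) -
        (‖ξ‖ : ℂ) ^ 2 / 2 := by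
    have hsq : ((√2 : ℝ) : ℂ) ^ 2 = 2 := by norm_cast; simp
    rw [← sum_ofReal_sq, Finset.mul_sum]
    simp only [← Finset.sum_neg_distrib, Finset.sum_div, ← Finset.sum_add_distrib,
      ← Finset.sum_sub_distrib]
    refine Finset.sum_congr rfl fun j _ => ?_
    push_cast
    linear_combination (z j ^ 2 / 2) * hsq + (z j ^ 2 / 2 + ξ j ^ 2 / 2) * Complex.I_sq
  have hconst :
      (((2 * Real.pi) ^ (-(n : ℝ) / 2) : ℝ) : ℂ) * (√(Real.pi / (1 / 2)) ^ n : ℝ) = 1 := by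
    rw [← Complex.ofReal_mul, Complex.ofReal_eq_one, Real.sqrt_eq_rpow,
      ← Real.rpow_mul_natCast (by positivity), show Real.pi / (1 / 2) = 2 * Real.pi by ring,
      ← Real.rpow_add (by positivity)]
    convert Real.rpow_zero _ using 2
    ring
  simp only [unitaryFourier, hprod, integral_const_mul]
  rw [integral_cexp_neg_mul_norm_sq_add_sum one_half_pos, bargmannKernel, ← hexp, Complex.exp_add]
  linear_combination (((√√Real.pi)⁻¹ ^ n : ℝ) * Complex.exp (-(∑ j, z j ^ 2) / 2) *
    Complex.exp ((∑ j, (√2 * z j - Complex.I * ξ j) ^ 2) / (4 * (1 / 2 : ℝ)))) * hconst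

theorem hasSum_cexp_sum_mul (w z : Fin n → ℂ) :
    HasSum (fun α : Fin n → ℕ =>
      (fockWeight α : ℂ) * ((fockWeight α : ℂ) * ∏ j, w j ^ α j) * ∏ j, z j ^ α j)
      (Complex.exp (∑ j, w j * z j)) := by
  have hexp (j : Fin n) : HasSum (fun k : ℕ => (w j * z j) ^ k / k.factorial)
      (Complex.exp (w j * z j)) := by
    rw [Complex.exp_eq_exp_ℂ]
    exact NormedSpace.expSeries_div_hasSum_exp _
  have hweight (k : ℕ) : (((√(k.factorial : ℝ))⁻¹ : ℝ) : ℂ) * ((√(k.factorial : ℝ))⁻¹ : ℝ) =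
      (k.factorial : ℂ)⁻¹ := by
    rw [← Complex.ofReal_mul, ← mul_inv, Real.mul_self_sqrt k.factorial.cast_nonneg]
    simp
  rw [Complex.exp_sum]
  refine (hasSum_prod_pi hexp fun j => (hexp j).summable.norm).1.congr_fun fun α => ?_
  simp only [fockWeight, Complex.ofReal_prod, ← Finset.prod_mul_distrib]
  refine Finset.prod_congr rfl fun j _ => ?_
  rw [← mul_assoc, hweight, mul_pow]
  ring

theorem gaussIntegrable_bargmannKernel (z : Fin n → ℂ) : GaussIntegrable (bargmannKernel z) := by
  rw [bargmannKernel_eq_hermiteSeries]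
  exact (rapidDecay_fockWeight_mul_prod_pow z).gaussIntegrable_hermiteSeries

theorem fockWeight_le_one (α : Fin n → ℕ) : fockWeight α ≤ 1 := by
  refine Finset.prod_le_one (fun j _ => by positivity) fun j _ => inv_le_one_of_one_le₀ ?_
  rw [Real.one_le_sqrt]
  exact_mod_cast (α j).factorial_pos

theorem RapidDecay.fockWeight_mul {c : (Fin n → ℕ) → ℂ} (hc : RapidDecay c) :
    RapidDecay fun α => fockWeight α * c α := by
  refine hc.of_norm_le (A := 1) zero_le_one fun α => ?_
  rw [norm_mul, norm_fockWeight, one_pow, mul_one]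
  exact mul_le_mul_of_nonneg_right (fockWeight_le_one α) (norm_nonneg _)

theorem hermiteCoeff_bargmannKernel (w : Fin n → ℂ) :
    hermiteCoeff (bargmannKernel w) = fun α => (fockWeight α : ℂ) * ∏ j, w j ^ α j := by
  refine (gaussIntegrable_bargmannKernel w).hermiteCoeff_eq
    (rapidDecay_fockWeight_mul_prod_pow w).fockWeight_mul fun z => ?_
  rw [bargmann_bargmannKernel, (hasSum_cexp_sum_mul w z).tsum_eq]

theorem RapidDecay.hermiteCoeff_hermiteSeries {c : (Fin n → ℕ) → ℂ} (hc : RapidDecay c) :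
    hermiteCoeff (hermiteSeries c) = c := by
  refine hc.gaussIntegrable_hermiteSeries.hermiteCoeff_eq hc.fockWeight_mul fun z => ?_
  simp only [bargmann, mul_comm (hermiteSeries c _)]
  rw [hc.integral_mul_hermiteSeries (gaussIntegrable_bargmannKernel z), hermiteCoeff_bargmannKernel]
  exact tsum_congr fun α => by ring

end BargmannTransform

section FourierTransform

variable {n : ℕ} {f g : EuclideanSpace ℝ (Fin n) → ℂ} {c : (Fin n → ℕ) → ℂ}

theorem unitaryFourier_eq_fourierIntegral (f : EuclideanSpace ℝ (Fin n) → ℂ) :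
    unitaryFourier f = (((2 * Real.pi) ^ (-(n : ℝ) / 2) : ℝ) : ℂ) •
      VectorFourier.fourierIntegral Real.probChar volume (innerₗ _) f := by
  ext ξ
  rw [Pi.smul_apply, VectorFourier.fourierIntegral_probChar]
  simp only [unitaryFourier, innerₗ_apply_apply, smul_eq_mul, neg_mul, mul_comm Complex.I]

theorem continuous_unitaryFourier (hf : Integrable f) : Continuous (unitaryFourier f) := by
  rw [unitaryFourier_eq_fourierIntegral]
  exact (VectorFourier.fourierIntegral_continuous Real.continuous_probChar
    continuous_inner hf).const_smul _

theorem norm_unitaryFourier_le (f : EuclideanSpace ℝ (Fin n) → ℂ)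
    (ξ : EuclideanSpace ℝ (Fin n)) :
    ‖unitaryFourier f ξ‖ ≤ (2 * Real.pi) ^ (-(n : ℝ) / 2) * ∫ x, ‖f x‖ := by
  rw [unitaryFourier_eq_fourierIntegral, Pi.smul_apply, norm_smul, Complex.norm_real,
    Real.norm_of_nonneg (by positivity)]
  gcongr
  exact VectorFourier.norm_fourierIntegral_le_integral_norm _ _ _ _ _

theorem integral_unitaryFourier_mul_eq (hf : Integrable f) (hg : Integrable g) :
    ∫ ξ, unitaryFourier f ξ * g ξ = ∫ x, f x * unitaryFourier g x := by
  have hflip := VectorFourier.integral_fourierIntegral_smul_eq_flip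
    (L := innerₗ (EuclideanSpace ℝ (Fin n))) (μ := volume) (ν := volume)
    Real.continuous_probChar continuous_inner hf hg
  rw [flip_innerₗ] at hflip
  simp only [smul_eq_mul] at hflip
  simp only [unitaryFourier_eq_fourierIntegral, Pi.smul_apply, smul_eq_mul, mul_assoc,
    mul_left_comm (f _), integral_const_mul, hflip]

theorem memLp_unitaryFourier (hf : Integrable f) : MemLp (unitaryFourier f) ⊤ :=
  memLp_top_of_bound (continuous_unitaryFourier hf).aestronglyMeasurable _
    (Eventually.of_forall (norm_unitaryFourier_le f))

theorem gaussIntegrable_unitaryFourier (hf : Integrable f) : GaussIntegrable (unitaryFourier f) :=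
  gaussIntegrable_of_memLp le_top (memLp_unitaryFourier hf)

theorem gaussIntegrable_of_integrable (hf : Integrable f) : GaussIntegrable f :=
  gaussIntegrable_of_memLp le_rfl (memLp_one_iff_integrable.2 hf)

theorem integrable_bargmannKernel (z : Fin n → ℂ) : Integrable (bargmannKernel z) := by
  rw [bargmannKernel_eq_hermiteSeries, ← memLp_one_iff_integrable]
  exact (rapidDecay_fockWeight_mul_prod_pow z).memLp_hermiteSeries 1

theorem bargmann_unitaryFourier (hf : Integrable f) (z : Fin n → ℂ) :
    bargmann (unitaryFourier f) z = bargmann f fun j => -Complex.I * z j := by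
  rw [bargmann, integral_unitaryFourier_mul_eq hf (integrable_bargmannKernel z),
    unitaryFourier_bargmannKernel, bargmann]

theorem RapidDecay.neg_I_pow_mul (hc : RapidDecay c) :
    RapidDecay fun α => (-Complex.I) ^ multiDegree α * c α :=
  hc.of_norm_le (A := 1) zero_le_one fun α => by simp

theorem hermiteCoeff_unitaryFourier (hf : Integrable f) :
    hermiteCoeff (unitaryFourier f) = fun α => (-Complex.I) ^ multiDegree α * hermiteCoeff f α := by
  have hfg := gaussIntegrable_of_integrable hf
  refine (gaussIntegrable_unitaryFourier hf).hermiteCoeff_eq ?_ fun z => ?_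
  · simp only [mul_left_comm (fockWeight _ : ℂ)]
    exact hfg.rapidDecay_fockWeight_mul_hermiteCoeff.neg_I_pow_mul
  · rw [bargmann_unitaryFourier hf, hfg.bargmann_eq]
    exact tsum_congr fun α => by rw [prod_mul_pow]; ring

theorem fourier_eq_unitaryFourier (g : EuclideanSpace ℝ (Fin n) → ℂ)
    (ξ : EuclideanSpace ℝ (Fin n)) :
    ((2 * Real.pi) ^ (-(n : ℝ) / 2) : ℝ) * FourierTransform.fourier g ξ =
      unitaryFourier g ((2 * Real.pi) • ξ) := by
  rw [Real.fourier_eq', unitaryFourier]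
  simp only [inner_smul_right, smul_eq_mul]
  congr! 5
  push_cast
  ring

theorem eq_zero_of_unitaryFourier_eq_zero (hc : Continuous g) (hg : Integrable g)
    (h : unitaryFourier g = 0) : g = 0 := by
  have hfourier : FourierTransform.fourier g = 0 := by
    ext ξ
    refine (mul_eq_zero_iff_left ?_).1 ((fourier_eq_unitaryFourier g ξ).trans (congrFun h _))
    exact Complex.ofReal_ne_zero.2 (by positivity)
  have hinv := hc.fourierInv_fourier_eq hg (by rw [hfourier]; exact integrable_zero _ _ _)
  rw [← hinv, hfourier]
  ext x
  simp [Real.fourierInv_eq']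

theorem bargmann_neg_I_mul (f : EuclideanSpace ℝ (Fin n) → ℂ) (ξ : EuclideanSpace ℝ (Fin n)) :
    bargmann f (fun j => -Complex.I * (ξ j / √2)) =
      ((√√Real.pi)⁻¹ ^ n : ℝ) * Complex.exp ((‖ξ‖ : ℂ) ^ 2 / 4) *
        ∫ x, Complex.exp (-Complex.I * ((inner ℝ x ξ : ℝ) : ℂ)) *
          (f x * Complex.exp (-(‖x‖ : ℂ) ^ 2 / 2)) := by
  have hsq : ((√2 : ℝ) : ℂ) ^ 2 = 2 := by norm_cast; simp
  have h2 : ((√2 : ℝ) : ℂ) ≠ 0 := by norm_cast; positivity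
  rw [bargmann, ← integral_const_mul]
  congr 1 with x
  have hexp : -(∑ j, (-Complex.I * (ξ j / √2)) ^ 2) / 2 +
      √2 * ∑ j, (x j : ℂ) * (-Complex.I * (ξ j / √2)) - (‖x‖ : ℂ) ^ 2 / 2 =
      (‖ξ‖ : ℂ) ^ 2 / 4 + (-Complex.I * ((inner ℝ x ξ : ℝ) : ℂ) + -(‖x‖ : ℂ) ^ 2 / 2) := by
    simp only [← sum_ofReal_sq, PiLp.inner_apply, RCLike.inner_apply, conj_trivial,
      Complex.ofReal_sum, Complex.ofReal_mul, Finset.mul_sum, ← Finset.sum_neg_distrib,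
      Finset.sum_div, ← Finset.sum_add_distrib, ← Finset.sum_sub_distrib]
    refine Finset.sum_congr rfl fun j _ => ?_
    field_simp
    linear_combination (-4 * ξ j ^ 2) * Complex.I_sq - (2 * ξ j ^ 2) * hsq
  rw [bargmannKernel, hexp, Complex.exp_add, Complex.exp_add]
  ring

theorem eq_zero_of_hermiteCoeff_eq_zero (hc : Continuous f) (hf : GaussIntegrable f)
    (h : hermiteCoeff f = 0) : f = 0 := by
  have hgauss : (fun x => f x * Complex.exp (-(‖x‖ : ℂ) ^ 2 / 2)) = 0 := by
    refine eq_zero_of_unitaryFourier_eq_zero (by fun_prop)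
      (hf.integrable_mul (by fun_prop) (D := 1) fun x => ?_) ?_
    · rw [one_mul, norm_cexp_neg_norm_sq_div_two, Real.exp_le_exp]
      linarith [sq_nonneg ‖x‖]
    · ext ξ
      have hbarg := hf.bargmann_eq fun j => -Complex.I * (ξ j / √2)
      simp only [bargmann_neg_I_mul, h, Pi.zero_apply, mul_zero, zero_mul, tsum_zero] at hbarg
      have hconst : (((√√Real.pi)⁻¹ ^ n : ℝ) : ℂ) ≠ 0 :=
        Complex.ofReal_ne_zero.2 (by positivity)
      rw [unitaryFourier,
        (mul_eq_zero_iff_left (mul_ne_zero hconst (Complex.exp_ne_zero _))).1 hbarg, mul_zero,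
        Pi.zero_apply]
  ext x
  exact (mul_eq_zero_iff_right (Complex.exp_ne_zero _)).1 (congrFun hgauss x)

theorem GaussIntegrable.eq_hermiteSeries (hf : GaussIntegrable f) (hcont : Continuous f)
    (hc : RapidDecay (hermiteCoeff f)) : f = hermiteSeries (hermiteCoeff f) := by
  refine sub_eq_zero.1 (eq_zero_of_hermiteCoeff_eq_zero (hcont.sub hc.continuous_hermiteSeries)
    (hf.sub hc.gaussIntegrable_hermiteSeries) ?_)
  rw [hf.hermiteCoeff_sub hc.gaussIntegrable_hermiteSeries, hc.hermiteCoeff_hermiteSeries, sub_self]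

theorem RapidDecay.integrable_hermiteSeries (hc : RapidDecay c) : Integrable (hermiteSeries c) :=
  memLp_one_iff_integrable.1 (hc.memLp_hermiteSeries 1)

theorem RapidDecay.unitaryFourier_hermiteSeries (hc : RapidDecay c) :
    unitaryFourier (hermiteSeries c) =
      hermiteSeries fun α => (-Complex.I) ^ multiDegree α * c α := by
  have hint := hc.integrable_hermiteSeries
  have hcoeff := hermiteCoeff_unitaryFourier hint
  rw [hc.hermiteCoeff_hermiteSeries] at hcoeff
  rw [(gaussIntegrable_unitaryFourier hint).eq_hermiteSeries (continuous_unitaryFourier hint)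
    (hcoeff ▸ hc.neg_I_pow_mul), hcoeff]

end FourierTransform

section HermiteBergmanInfinity

variable {n : ℕ} {c d : (Fin n → ℕ) → ℂ} {f : EuclideanSpace ℝ (Fin n) → ℂ}

theorem exp_neg_hermiteEigenvalue_mul (t : ℝ) (α : Fin n → ℕ) :
    Real.exp (-((2 * ∑ j, (α j : ℝ)) + n) * t) =
      Real.exp (-(n * t)) * Real.exp (-(2 * t)) ^ multiDegree α := by
  rw [← Real.exp_nat_mul, ← Real.exp_add, multiDegree]
  push_cast
  ring_nf

theorem rapidDecay_indicator (s : Finset (Fin n → ℕ)) (d : (Fin n → ℕ) → ℂ) :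
    RapidDecay ((s : Set (Fin n → ℕ)).indicator d) := fun T _ =>
  summable_of_ne_finset_zero (s := s) fun α hα => by
    rw [Set.indicator_of_notMem (by simpa using hα), norm_zero, zero_mul]

theorem hermiteSeries_indicator (s : Finset (Fin n → ℕ)) (d : (Fin n → ℕ) → ℂ) :
    hermiteSeries ((s : Set (Fin n → ℕ)).indicator d) =
      fun x => ∑ α ∈ s, d α * (hermiteFunction α x : ℂ) := by
  ext x
  rw [hermiteSeries, tsum_eq_sum (s := s) fun α hα => by
    rw [Set.indicator_of_notMem (by simpa using hα), zero_mul]]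
  exact Finset.sum_congr rfl fun α hα => by rw [Set.indicator_of_mem (by simpa using hα)]

theorem enorm_integral_mul_le {V : Type*} [MeasurableSpace V] {μ : Measure V} {f g : V → ℂ}
    (hf : AEStronglyMeasurable f μ) (hg : AEStronglyMeasurable g μ) :
    ‖∫ x, f x * g x ∂μ‖ₑ ≤ eLpNorm f 2 μ * eLpNorm g 2 μ := by
  refine (enorm_integral_le_lintegral_enorm _).trans ?_
  rw [← eLpNorm_one_eq_lintegral_enorm]
  exact eLpNorm_smul_le_mul_eLpNorm (𝕜 := ℂ) (φ := f) (f := g) hg hf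

section L2Convergence

variable (h : Tendsto (fun s : Finset (Fin n → ℕ) =>
  eLpNorm (fun x => f x - ∑ α ∈ s, d α * (hermiteFunction α x : ℂ)) 2 volume) atTop (𝓝 0))
include h

theorem memLp_of_tendsto_sum_hermiteFunction (hf : AEStronglyMeasurable f) : MemLp f 2 := by
  obtain ⟨s, hs⟩ := (h.eventually_lt_const ENNReal.zero_lt_top).exists
  have hsum := (rapidDecay_indicator s d).memLp_hermiteSeries 2
  rw [hermiteSeries_indicator] at hsum
  have hsub : MemLp (fun x => f x - ∑ α ∈ s, d α * (hermiteFunction α x : ℂ)) 2 :=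
    ⟨hf.sub hsum.1, hs⟩
  simpa only [Pi.add_def, sub_add_cancel] using hsub.add hsum

theorem hermiteCoeff_eq_of_tendsto_sum_hermiteFunction (hf : AEStronglyMeasurable f) :
    hermiteCoeff f = d := by
  have hf' := gaussIntegrable_of_memLp one_le_two (memLp_of_tendsto_sum_hermiteFunction h hf)
  ext β
  have hle : ∀ᶠ s : Finset (Fin n → ℕ) in atTop, ‖hermiteCoeff f β - d β‖ₑ ≤
      eLpNorm (fun x => f x - ∑ α ∈ s, d α * (hermiteFunction α x : ℂ)) 2 volume *
        eLpNorm (fun x => (hermiteFunction β x : ℂ)) 2 volume := by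
    filter_upwards [eventually_ge_atTop {β}] with s hβ
    have hs := rapidDecay_indicator s d
    have hcoeff : hermiteCoeff (f - hermiteSeries ((s : Set (Fin n → ℕ)).indicator d)) β =
        hermiteCoeff f β - d β := by
      rw [hf'.hermiteCoeff_sub hs.gaussIntegrable_hermiteSeries, Pi.sub_apply,
        hs.hermiteCoeff_hermiteSeries,
        Set.indicator_of_mem (by simpa using hβ)]
    have hmeas := hf.sub hs.continuous_hermiteSeries.aestronglyMeasurable
    rw [← hcoeff]
    rw [hermiteSeries_indicator] at hmeas ⊢
    exact enorm_integral_mul_le hmeas (memLp_hermiteFunction β 2).1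
  have hlim := ENNReal.Tendsto.mul_const h (Or.inr (memLp_hermiteFunction β 2).2.ne)
  rw [zero_mul] at hlim
  exact sub_eq_zero.1 (enorm_eq_zero.1 (le_antisymm (ge_of_tendsto hlim hle) zero_le))

end L2Convergence

theorem RapidDecay.tendsto_eLpNorm_sub (hc : RapidDecay c) :
    Tendsto (fun s : Finset (Fin n → ℕ) => eLpNorm (fun x => hermiteSeries c x -
      ∑ α ∈ s, c α * (hermiteFunction α x : ℂ)) 2 volume) atTop (𝓝 0) := by
  set B := Real.exp (5 / 2)
  set g := fun x : EuclideanSpace ℝ (Fin n) => Real.exp (-(1 / 4) * ‖x‖ ^ 2)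
  have hs : Summable fun α => ‖c α‖ * B ^ multiDegree α := hc B (Real.exp_pos _).le
  have hle (s : Finset (Fin n → ℕ)) : eLpNorm (fun x => hermiteSeries c x -
      ∑ α ∈ s, c α * (hermiteFunction α x : ℂ)) 2 volume ≤
      ENNReal.ofReal (∑' α : {α // α ∉ s}, ‖c α‖ * B ^ multiDegree (α : Fin n → ℕ)) *
        eLpNorm g 2 volume := by
    refine eLpNorm_le_mul_eLpNorm_of_ae_le_mul (Eventually.of_forall fun x => ?_) 2
    have hterm (α : Fin n → ℕ) : ‖c α * (hermiteFunction α x : ℂ)‖ ≤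
        ‖c α‖ * B ^ multiDegree α * g x := by
      rw [norm_mul, mul_assoc]
      gcongr
      exact norm_hermiteFunction_le_gaussian α x
    have hsum : Summable fun α => c α * (hermiteFunction α x : ℂ) :=
      (hs.mul_right _).of_norm_bounded hterm
    rw [hermiteSeries, ← hsum.sum_add_tsum_subtype_compl s, add_sub_cancel_left,
      Real.norm_of_nonneg (Real.exp_pos _).le, ← tsum_mul_right]
    exact tsum_of_norm_bounded ((hs.mul_right _).subtype _).hasSum fun α => hterm α
  have htail := ENNReal.Tendsto.mul_const (b := eLpNorm g 2 volume) (ENNReal.tendsto_ofReal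
    (tendsto_tsum_compl_atTop_zero fun α : Fin n → ℕ => ‖c α‖ * B ^ multiDegree α))
    (Or.inr (memLp_exp_neg_mul_norm_sq (by norm_num) 2).2.ne)
  rw [ENNReal.ofReal_zero, zero_mul] at htail
  exact tendsto_of_tendsto_of_tendsto_of_le_of_le tendsto_const_nhds htail (fun _ => zero_le) hle

theorem RapidDecay.exists_isHermiteSemigroup (hc : RapidDecay c) (t : ℝ) :
    ∃ φ : EuclideanSpace ℝ (Fin n) → ℂ,
      MemLp φ 2 volume ∧ IsHermiteSemigroup t φ (hermiteSeries c) := by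
  let b : (Fin n → ℕ) → ℂ := fun α =>
    ((Real.exp (n * t) * Real.exp (2 * t) ^ multiDegree α : ℝ) : ℂ) * c α
  have hb : RapidDecay b :=
    hc.of_norm_le (A := Real.exp (n * t)) (B := Real.exp (2 * t)) (Real.exp_pos _).le fun α => by
      rw [norm_mul, Complex.norm_real, Real.norm_of_nonneg (by positivity)]
      exact le_of_eq (by ring)
  have hcancel (α : Fin n → ℕ) :
      (Real.exp (-((2 * ∑ j, (α j : ℝ)) + n) * t) : ℂ) * b α = c α := by
    rw [exp_neg_hermiteEigenvalue_mul, ← mul_assoc, ← Complex.ofReal_mul, mul_mul_mul_comm,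
      ← mul_pow, ← Real.exp_add, ← Real.exp_add]
    simp
  refine ⟨hermiteSeries b, hb.memLp_hermiteSeries 2, ?_⟩
  simp only [IsHermiteSemigroup, hb.hermiteCoeff_hermiteSeries, hcancel]
  exact hc.tendsto_eLpNorm_sub

theorem RapidDecay.hermiteEntire_mem (hc : RapidDecay c) :
    hermiteEntire c ∈ HermiteBergmanInf n := by
  refine Set.mem_iInter₂.2 fun t _ => ⟨hc.differentiable_hermiteEntire, ?_⟩
  rw [realRestriction_hermiteEntire]
  exact hc.exists_isHermiteSemigroup t

theorem rapidDecay_of_forall_isHermiteSemigroup (hf : AEStronglyMeasurable f)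
    (h : ∀ t > 0, ∃ φ : EuclideanSpace ℝ (Fin n) → ℂ, MemLp φ 2 ∧ IsHermiteSemigroup t φ f) :
    RapidDecay (hermiteCoeff f) := by
  refine RapidDecay.of_bound fun T hT => ?_
  -- With this `t` the factor `e^{-2t}` beats the geometric rate `e^{5/2} T`, as `t e^{-2t} ≤ 1`.
  set t := Real.exp (5 / 2) * T with ht_def
  have ht : 0 < t := by positivity
  have hle_one : t * Real.exp (-(2 * t)) ≤ 1 := by
    rw [Real.exp_neg, ← div_eq_mul_inv, div_le_one (Real.exp_pos _)]
    linarith [Real.add_one_le_exp (2 * t)]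
  obtain ⟨φ, hφ, hsemi⟩ := h t ht
  have hφ' := gaussIntegrable_of_memLp one_le_two hφ
  set M := ∫ x, ‖φ x * (Real.exp (-(1 / 4) * ‖x‖ ^ 2) : ℂ)‖
  refine ⟨Real.exp (-(n * t)) * M, fun α => ?_⟩
  rw [hermiteCoeff_eq_of_tendsto_sum_hermiteFunction hsemi hf, norm_mul, Complex.norm_real,
    Real.norm_of_nonneg (Real.exp_pos _).le, exp_neg_hermiteEigenvalue_mul]
  calc Real.exp (-(n * t)) * Real.exp (-(2 * t)) ^ multiDegree α * ‖hermiteCoeff φ α‖ *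
        T ^ multiDegree α
      ≤ Real.exp (-(n * t)) * Real.exp (-(2 * t)) ^ multiDegree α *
          (M * Real.exp (5 / 2) ^ multiDegree α) * T ^ multiDegree α := by
        gcongr
        exact hφ'.norm_hermiteCoeff_le α
    _ = Real.exp (-(n * t)) * M * (t * Real.exp (-(2 * t))) ^ multiDegree α := by
        rw [ht_def, mul_pow, mul_pow]
        ring
    _ ≤ Real.exp (-(n * t)) * M :=
        mul_le_of_le_one_right (by positivity) (pow_le_one₀ (by positivity) hle_one)

theorem eq_of_realRestriction_eq {F G : EuclideanSpace ℂ (Fin n) → ℂ}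
    (hF : Differentiable ℂ F) (hG : Differentiable ℂ G)
    (h : realRestriction F = realRestriction G) : F = G := by
  ext z
  let x : EuclideanSpace ℝ (Fin n) := WithLp.toLp 2 fun j => (z j).re
  let y : EuclideanSpace ℝ (Fin n) := WithLp.toLp 2 fun j => (z j).im
  let L : ℂ → EuclideanSpace ℂ (Fin n) := fun w => realToComplex x + w • realToComplex y
  have hL : Differentiable ℂ L := by fun_prop
  have hL_real (t : ℝ) : L t = realToComplex (x + t • y) := by ext j; simp [L]
  have hL_I : L Complex.I = z := by
    ext j
    simp only [L, PiLp.add_apply, PiLp.smul_apply, realToComplex_apply, smul_eq_mul, x, y]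
    rw [mul_comm]
    exact Complex.re_add_im (z j)
  have hreal : Tendsto (fun t : ℝ => (t : ℂ)) (𝓝[≠] 0) (𝓝[≠] 0) :=
    Complex.continuous_ofReal.continuousWithinAt.tendsto_nhdsWithin fun _ ht =>
      Complex.ofReal_ne_zero.2 ht
  have hfreq : ∃ᶠ w in 𝓝[≠] (0 : ℂ), F (L w) = G (L w) :=
    hreal.frequently (Frequently.of_forall fun t => by
      rw [hL_real]
      exact congrFun h (x + t • y))
  have hanalytic {E : EuclideanSpace ℂ (Fin n) → ℂ} (hE : Differentiable ℂ E) :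
      AnalyticOnNhd ℂ (fun w => E (L w)) Set.univ := fun w _ => (hE.comp hL).analyticAt w
  simpa only [hL_I] using
    congrFun ((hanalytic hF).eq_of_frequently_eq (hanalytic hG) hfreq) Complex.I

theorem RapidDecay.eq_hermiteEntire_iff (hc : RapidDecay c) {F : EuclideanSpace ℂ (Fin n) → ℂ}
    (hF : Differentiable ℂ F) : F = hermiteEntire c ↔ realRestriction F = hermiteSeries c := by
  rw [← realRestriction_hermiteEntire]
  exact ⟨congrArg realRestriction, eq_of_realRestriction_eq hF hc.differentiable_hermiteEntire⟩

theorem mem_hermiteBergmanInf_iff {F : EuclideanSpace ℂ (Fin n) → ℂ} :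
    F ∈ HermiteBergmanInf n ↔ ∃ c, RapidDecay c ∧ F = hermiteEntire c := by
  refine ⟨fun hF => ?_, fun ⟨c, hc, hFc⟩ => hFc ▸ hc.hermiteEntire_mem⟩
  have hmem : ∀ t > 0, F ∈ HermiteBergman n t := Set.mem_iInter₂.1 hF
  have hdiff : Differentiable ℂ F := (hmem 1 one_pos).1
  have hcont : Continuous (realRestriction F) := hdiff.continuous.comp continuous_realToComplex
  have hmeas := hcont.aestronglyMeasurable (μ := volume)
  have hdecay := rapidDecay_of_forall_isHermiteSemigroup hmeas fun t ht => (hmem t ht).2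
  obtain ⟨φ, -, hsemi⟩ := (hmem 1 one_pos).2
  have hgauss := gaussIntegrable_of_memLp one_le_two
    (memLp_of_tendsto_sum_hermiteFunction hsemi hmeas)
  exact ⟨_, hdecay, (hdecay.eq_hermiteEntire_iff hdiff).2 (hgauss.eq_hermiteSeries hcont hdecay)⟩

end HermiteBergmanInfinity

section PhragmenLindelofArgument

variable {ι : Type*} (a b : ι → ℝ)

/-- The curve `ζ ↦ e^ζ a + e^{-ζ} b` in `ℂⁿ`. It is real on the line `im ζ = 0` and purely
imaginary on the line `im ζ = π / 2`, and any given point of `ℂⁿ` is its value at `ζ = iπ / 4` for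
suitable `a` and `b`. -/
def expCurve (ζ : ℂ) (j : ι) : ℂ := Complex.exp ζ * a j + Complex.exp (-ζ) * b j

theorem re_expCurve (ζ : ℂ) (j : ι) : (expCurve a b ζ j).re =
    Real.cos ζ.im * (Real.exp ζ.re * a j + Real.exp (-ζ.re) * b j) := by
  simp only [expCurve, Complex.add_re, Complex.re_mul_ofReal, Complex.exp_re, Complex.neg_re,
    Complex.neg_im, Real.cos_neg]
  ring

theorem im_expCurve (ζ : ℂ) (j : ι) : (expCurve a b ζ j).im =
    Real.sin ζ.im * (Real.exp ζ.re * a j - Real.exp (-ζ.re) * b j) := by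
  simp only [expCurve, Complex.add_im, Complex.im_mul_ofReal, Complex.exp_im, Complex.neg_re,
    Complex.neg_im, Real.sin_neg]
  ring

theorem differentiable_expCurve : Differentiable ℂ (expCurve a b) :=
  differentiable_pi.2 fun j => by unfold expCurve; fun_prop

variable [Fintype ι]

/-- The mean of the squared norms of `e^s a + e^{-s} b` and `e^s a - e^{-s} b`, which controls the
real and imaginary parts of `expCurve a b` on the line `re ζ = s`. -/
def expCurveEnergy (s : ℝ) : ℝ :=
  Real.exp (2 * s) * ∑ j, a j ^ 2 + Real.exp (-(2 * s)) * ∑ j, b j ^ 2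

/-- The zero-free entire function whose modulus at `ζ` is
`exp (-(δ * sin (2 * im ζ) * expCurveEnergy a b (re ζ)))`. -/
def expCurveWeight (δ : ℝ) (ζ : ℂ) : ℂ :=
  Complex.exp (Complex.I * δ * ((∑ j, a j ^ 2 : ℝ) * Complex.exp (2 * ζ) -
    (∑ j, b j ^ 2 : ℝ) * Complex.exp (-(2 * ζ))))

theorem expCurveEnergy_nonneg (s : ℝ) : 0 ≤ expCurveEnergy a b s := by
  unfold expCurveEnergy
  positivity

theorem sum_sq_exp_add_exp_le (s : ℝ) :
    ∑ j, (Real.exp s * a j + Real.exp (-s) * b j) ^ 2 ≤ 2 * expCurveEnergy a b s := by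
  have hexp (t : ℝ) : Real.exp (2 * t) = Real.exp t ^ 2 := by
    rw [← Real.exp_nat_mul, Nat.cast_ofNat]
  rw [expCurveEnergy, ← mul_neg, hexp, hexp, Finset.mul_sum, Finset.mul_sum,
    ← Finset.sum_add_distrib, Finset.mul_sum]
  gcongr with j
  simpa only [mul_pow] using
    add_sq_le (a := Real.exp s * a j) (b := Real.exp (-s) * b j)

theorem sum_re_expCurve_sq_le (ζ : ℂ) : ∑ j, (expCurve a b ζ j).re ^ 2 ≤
    Real.cos ζ.im ^ 2 * (2 * expCurveEnergy a b ζ.re) := by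
  simp only [re_expCurve, mul_pow, ← Finset.mul_sum]
  gcongr
  exact sum_sq_exp_add_exp_le a b ζ.re

theorem sum_im_expCurve_sq_le (ζ : ℂ) : ∑ j, (expCurve a b ζ j).im ^ 2 ≤
    Real.sin ζ.im ^ 2 * (2 * expCurveEnergy a b ζ.re) := by
  simp only [im_expCurve, mul_pow, ← Finset.mul_sum]
  gcongr
  simpa [expCurveEnergy, sub_eq_add_neg] using sum_sq_exp_add_exp_le a (fun j => -b j) ζ.re

theorem expCurveEnergy_le (s : ℝ) :
    expCurveEnergy a b s ≤ expCurveEnergy a b 0 * Real.exp (2 * |s|) := by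
  have hpos : Real.exp (2 * s) ≤ Real.exp (2 * |s|) := by gcongr; exact le_abs_self s
  have hneg : Real.exp (-(2 * s)) ≤ Real.exp (2 * |s|) := by
    rw [← mul_neg]; gcongr; exact neg_le_abs s
  calc expCurveEnergy a b s
      ≤ Real.exp (2 * |s|) * ∑ j, a j ^ 2 + Real.exp (2 * |s|) * ∑ j, b j ^ 2 := by
        unfold expCurveEnergy
        gcongr
    _ = expCurveEnergy a b 0 * Real.exp (2 * |s|) := by
        simp only [expCurveEnergy, mul_zero, neg_zero, Real.exp_zero, one_mul]
        ring

theorem norm_expCurveWeight (δ : ℝ) (ζ : ℂ) : ‖expCurveWeight a b δ ζ‖ =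
    Real.exp (-(δ * Real.sin (2 * ζ.im) * expCurveEnergy a b ζ.re)) := by
  rw [expCurveWeight, Complex.norm_exp, mul_assoc, Complex.I_mul_re, Complex.im_ofReal_mul,
    Complex.sub_im, Complex.im_ofReal_mul, Complex.im_ofReal_mul, Complex.exp_im, Complex.exp_im,
    expCurveEnergy]
  simp only [Complex.neg_re, Complex.neg_im, Complex.mul_re, Complex.mul_im, Complex.re_ofNat,
    Complex.im_ofNat, zero_mul, sub_zero, add_zero, Real.sin_neg]
  congr 1
  ring

theorem exists_expCurve_eq (w : ι → ℂ) : ∃ a b : ι → ℝ,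
    expCurve a b ((Real.pi / 4 : ℝ) * Complex.I) = w ∧ expCurveEnergy a b 0 = ∑ j, ‖w j‖ ^ 2 := by
  have hsqrt : √2 ≠ (0 : ℝ) := by positivity
  refine ⟨fun j => ((w j).re + (w j).im) / √2, fun j => ((w j).re - (w j).im) / √2, ?_, ?_⟩
  · ext j
    apply Complex.ext
    · simp only [re_expCurve, Complex.re_ofReal_mul, Complex.im_ofReal_mul, Complex.I_re,
        Complex.I_im, mul_zero, mul_one, neg_zero, Real.exp_zero, one_mul, Real.cos_pi_div_four]
      field_simp
      ring
    · simp only [im_expCurve, Complex.re_ofReal_mul, Complex.im_ofReal_mul, Complex.I_re,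
        Complex.I_im, mul_zero, mul_one, neg_zero, Real.exp_zero, one_mul, Real.sin_pi_div_four]
      field_simp
      ring
  · simp only [expCurveEnergy, mul_zero, neg_zero, Real.exp_zero, one_mul,
      ← Finset.sum_add_distrib, div_pow, Real.sq_sqrt zero_le_two]
    refine Finset.sum_congr rfl fun j _ => ?_
    rw [← Complex.normSq_eq_norm_sq, Complex.normSq_apply]
    ring

theorem exists_angle {δ : ℝ} (hδ : 0 < δ) : ∃ θ ∈ Set.Ioo 0 (Real.pi / 4), ∃ ε > 0,
    Real.sin θ ^ 2 + 2 * ε ≤ δ * Real.sin (2 * θ) := by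
  obtain ⟨d, hd, hd_lt⟩ := exists_between (lt_min hδ one_pos)
  have hcos : 0 < Real.cos (Real.arctan d) := Real.cos_arctan_pos d
  have hsin : Real.sin (Real.arctan d) = d * Real.cos (Real.arctan d) := by
    rw [← Real.tan_mul_cos hcos.ne', Real.tan_arctan]
  have hlt : Real.sin (Real.arctan d) ^ 2 < δ * Real.sin (2 * Real.arctan d) := by
    have hdδ : d < 2 * δ := by linarith [hd_lt.trans_le (min_le_left _ _)]
    calc Real.sin (Real.arctan d) ^ 2 = d * (d * Real.cos (Real.arctan d) ^ 2) := by
          rw [hsin]; ring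
      _ < 2 * δ * (d * Real.cos (Real.arctan d) ^ 2) := by gcongr
      _ = δ * Real.sin (2 * Real.arctan d) := by rw [Real.sin_two_mul, hsin]; ring
  refine ⟨Real.arctan d, ⟨Real.arctan_pos.2 hd, ?_⟩, _, half_pos (sub_pos.2 hlt), by linarith⟩
  rw [← Real.arctan_one]
  exact Real.arctan_strictMono (hd_lt.trans_le (min_le_right _ _))

variable {B : (ι → ℂ) → ℂ} {C ε : ℝ} {a b}

theorem norm_comp_expCurve_le_of_re (hC : 0 ≤ C) (hε : 0 ≤ ε)
    (hB : ∀ z, ‖B z‖ ≤ C * Real.exp ((∑ j, (z j).im ^ 2) / 2 + ε * ∑ j, (z j).re ^ 2)) (ζ : ℂ) :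
    ‖B (expCurve a b ζ)‖ ≤
      C * Real.exp ((Real.sin ζ.im ^ 2 + 2 * ε) * expCurveEnergy a b ζ.re) := by
  refine (hB _).trans ?_
  have hE := expCurveEnergy_nonneg a b ζ.re
  have hre : ∑ j, (expCurve a b ζ j).re ^ 2 ≤ 2 * expCurveEnergy a b ζ.re :=
    (sum_re_expCurve_sq_le a b ζ).trans
      (mul_le_of_le_one_left (by positivity) (Real.cos_sq_le_one _))
  gcongr
  linarith [sum_im_expCurve_sq_le a b ζ, mul_le_mul_of_nonneg_left hre hε]

theorem norm_comp_expCurve_le_of_im (hC : 0 ≤ C) (hε : 0 ≤ ε)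
    (hB : ∀ z, ‖B z‖ ≤ C * Real.exp ((∑ j, (z j).re ^ 2) / 2 + ε * ∑ j, (z j).im ^ 2)) (ζ : ℂ) :
    ‖B (expCurve a b ζ)‖ ≤
      C * Real.exp ((Real.cos ζ.im ^ 2 + 2 * ε) * expCurveEnergy a b ζ.re) := by
  refine (hB _).trans ?_
  have hE := expCurveEnergy_nonneg a b ζ.re
  have him : ∑ j, (expCurve a b ζ j).im ^ 2 ≤ 2 * expCurveEnergy a b ζ.re :=
    (sum_im_expCurve_sq_le a b ζ).trans
      (mul_le_of_le_one_left (by positivity) (Real.sin_sq_le_one _))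
  gcongr
  linarith [sum_re_expCurve_sq_le a b ζ, mul_le_mul_of_nonneg_left him hε]

theorem norm_comp_expCurve_mul_weight_le (hC : 0 ≤ C) (hε : 0 ≤ ε)
    (hB : ∀ z, ‖B z‖ ≤ C * Real.exp ((∑ j, (z j).im ^ 2) / 2 + ε * ∑ j, (z j).re ^ 2))
    {δ : ℝ} (hδ : 0 ≤ δ) {ζ : ℂ} (hζ : ζ.im ∈ Set.Icc 0 (Real.pi / 2)) :
    ‖B (expCurve a b ζ) * expCurveWeight a b δ ζ‖ ≤
      C * Real.exp ((1 + 2 * ε) * expCurveEnergy a b 0 * Real.exp (2 * |ζ.re|)) := by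
  have hE := expCurveEnergy_nonneg a b ζ.re
  have hsin : 0 ≤ Real.sin (2 * ζ.im) :=
    Real.sin_nonneg_of_nonneg_of_le_pi (by linarith [hζ.1]) (by linarith [hζ.2])
  have hweight : ‖expCurveWeight a b δ ζ‖ ≤ 1 := by
    rw [norm_expCurveWeight]
    exact Real.exp_le_one_iff.2 (neg_nonpos.2 (by positivity))
  calc ‖B (expCurve a b ζ) * expCurveWeight a b δ ζ‖
      ≤ ‖B (expCurve a b ζ)‖ :=
        (norm_mul_le _ _).trans (mul_le_of_le_one_right (norm_nonneg _) hweight)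
    _ ≤ C * Real.exp ((Real.sin ζ.im ^ 2 + 2 * ε) * expCurveEnergy a b ζ.re) :=
        norm_comp_expCurve_le_of_re hC hε hB ζ
    _ ≤ C * Real.exp ((1 + 2 * ε) * expCurveEnergy a b 0 * Real.exp (2 * |ζ.re|)) := by
        rw [mul_assoc (1 + 2 * ε)]
        gcongr
        exacts [Real.sin_sq_le_one _, expCurveEnergy_le a b _]

theorem norm_le_of_re_im_bounds (hBd : Differentiable ℂ B) (hC : 0 ≤ C) (hε : 0 ≤ ε)
    (hre : ∀ z, ‖B z‖ ≤ C * Real.exp ((∑ j, (z j).im ^ 2) / 2 + ε * ∑ j, (z j).re ^ 2))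
    (him : ∀ z, ‖B z‖ ≤ C * Real.exp ((∑ j, (z j).re ^ 2) / 2 + ε * ∑ j, (z j).im ^ 2))
    {θ δ : ℝ} (hθ : θ ∈ Set.Ioo 0 (Real.pi / 4)) (hδ : 0 ≤ δ)
    (hθδ : Real.sin θ ^ 2 + 2 * ε ≤ δ * Real.sin (2 * θ)) (w : ι → ℂ) :
    ‖B w‖ ≤ C * Real.exp (δ * ∑ j, ‖w j‖ ^ 2) := by
  obtain ⟨hθ0, hθ4⟩ := hθ
  obtain ⟨a, b, hw, hE0⟩ := exists_expCurve_eq w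
  let g : ℂ → ℂ := fun ζ => B (expCurve a b ζ) * expCurveWeight a b δ ζ
  have hg (ζ : ℂ) : ‖g ζ‖ = ‖B (expCurve a b ζ)‖ *
      Real.exp (-(δ * Real.sin (2 * ζ.im) * expCurveEnergy a b ζ.re)) := by
    rw [norm_mul, norm_expCurveWeight]
  have hgd : Differentiable ℂ g :=
    (hBd.comp (differentiable_expCurve a b)).mul (by unfold expCurveWeight; fun_prop)
  have hedge {y s : ℝ}
      (hy : y ≤ C * Real.exp ((Real.sin θ ^ 2 + 2 * ε) * expCurveEnergy a b s)) :
      y * Real.exp (-(δ * Real.sin (2 * θ) * expCurveEnergy a b s)) ≤ C := by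
    rw [Real.exp_neg, ← div_eq_mul_inv, div_le_iff₀ (Real.exp_pos _)]
    refine hy.trans ?_
    gcongr
    exact expCurveEnergy_nonneg a b s
  have hangle : ((Real.pi / 4 : ℝ) * Complex.I).im = Real.pi / 4 := by simp
  have hcenter : ‖g ((Real.pi / 4 : ℝ) * Complex.I)‖ ≤ C := by
    refine PhragmenLindelof.horizontal_strip (a := θ) (b := Real.pi / 2 - θ) hgd.diffContOnCl
      ⟨2, ?_, (1 + 2 * ε) * expCurveEnergy a b 0, Asymptotics.IsBigO.of_bound C ?_⟩
      (fun ζ hζ => ?_) (fun ζ hζ => ?_) (by linarith) (by linarith)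
    · rw [lt_div_iff₀ (by linarith)]
      linarith
    · refine eventually_inf_principal.2 (Eventually.of_forall fun ζ hζ => ?_)
      rw [Real.norm_of_nonneg (Real.exp_pos _).le]
      exact norm_comp_expCurve_mul_weight_le hC hε hre hδ
        ⟨by linarith [hζ.1], by linarith [hζ.2]⟩
    · rw [hg, hζ]
      exact hedge (hζ ▸ norm_comp_expCurve_le_of_re hC hε hre ζ)
    · rw [hg, hζ, mul_sub, mul_div_cancel₀ _ two_ne_zero, Real.sin_pi_sub]
      refine hedge ?_
      rw [← Real.cos_pi_div_two_sub, ← hζ]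
      exact norm_comp_expCurve_le_of_im hC hε him ζ
  rwa [hg, hangle, hw, Complex.re_ofReal_mul, Complex.I_re, mul_zero, hE0,
    show 2 * (Real.pi / 4) = Real.pi / 2 by ring, Real.sin_pi_div_two, mul_one, Real.exp_neg,
    ← div_eq_mul_inv, div_le_iff₀ (Real.exp_pos _)] at hcenter

theorem exists_minimalType_bound (hBd : Differentiable ℂ B)
    (hB : ∀ ε > 0, ∃ C, 0 ≤ C ∧ ∀ z,
      ‖B z‖ ≤ C * Real.exp ((∑ j, (z j).im ^ 2) / 2 + ε * ∑ j, (z j).re ^ 2) ∧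
      ‖B z‖ ≤ C * Real.exp ((∑ j, (z j).re ^ 2) / 2 + ε * ∑ j, (z j).im ^ 2))
    {δ : ℝ} (hδ : 0 < δ) :
    ∃ C, ∀ z, ‖B z‖ ≤ C * Real.exp (δ * ∑ j, ‖z j‖ ^ 2) := by
  obtain ⟨θ, hθ, ε, hε, hθδ⟩ := exists_angle hδ
  obtain ⟨C, hC, hCB⟩ := hB ε hε
  exact ⟨C, norm_le_of_re_im_bounds hBd hC hε.le (fun z => (hCB z).1) (fun z => (hCB z).2) hθ
    hδ.le hθδ⟩

end PhragmenLindelofArgument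

section MinimalType

variable {n : ℕ} {b : (Fin n → ℕ) → ℂ} {f : EuclideanSpace ℝ (Fin n) → ℂ}

theorem inv_sqrt_factorial_multiDegree_le_fockWeight (α : Fin n → ℕ) :
    (√((multiDegree α).factorial : ℝ))⁻¹ ≤ fockWeight α := by
  rw [fockWeight, Finset.prod_inv_distrib]
  refine inv_anti₀ (Finset.prod_pos fun j _ => by positivity) (Real.le_sqrt_of_sq_le ?_)
  simp only [← Finset.prod_pow, Real.sq_sqrt (Nat.cast_nonneg _)]
  exact_mod_cast Nat.le_of_dvd (Nat.factorial_pos _)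
    (Nat.prod_factorial_dvd_factorial_sum Finset.univ α)

theorem one_le_fockWeight_mul_sqrt_pow (α : Fin n → ℕ) :
    1 ≤ fockWeight α * √(multiDegree α : ℝ) ^ multiDegree α := by
  have hfact : (0 : ℝ) < √((multiDegree α).factorial : ℝ) :=
    Real.sqrt_pos.2 (by exact_mod_cast (multiDegree α).factorial_pos)
  calc (1 : ℝ) = (√((multiDegree α).factorial : ℝ))⁻¹ * √((multiDegree α).factorial : ℝ) :=
        (inv_mul_cancel₀ hfact.ne').symm
    _ ≤ fockWeight α * √(multiDegree α : ℝ) ^ multiDegree α := by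
        gcongr
        exacts [(fockWeight_pos α).le, inv_sqrt_factorial_multiDegree_le_fockWeight α,
          sqrt_factorial_le_sqrt_pow _]

theorem RapidDecay.exists_norm_mul_sqrt_pow_mul_pow_le (hb : RapidDecay b)
    (hgrowth : ∀ δ > 0, ∃ C, ∀ z : Fin n → ℂ,
      ‖∑' α, b α * ∏ j, z j ^ α j‖ ≤ C * Real.exp (δ * ∑ j, ‖z j‖ ^ 2))
    {T : ℝ} (hT : 0 < T) :
    ∃ C, ∀ α, ‖b α‖ * √(multiDegree α : ℝ) ^ multiDegree α * T ^ multiDegree α ≤ C := by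
  -- Cauchy's estimate on the polycircle of radius `r = e T √|α|`, where `δ n r² ≤ |α|`.
  set L := Real.exp 1 * T with hL
  have hL0 : 0 < L := by positivity
  obtain ⟨C, hC⟩ := hgrowth (1 / ((n + 1) * L ^ 2)) (by positivity)
  have hC0 : 0 ≤ C := by
    have := (norm_nonneg _).trans (hC 0)
    exact nonneg_of_mul_nonneg_left this (Real.exp_pos _)
  refine ⟨C, fun α => ?_⟩
  set m := multiDegree α
  have hcauchy : ‖b α‖ * (√(m : ℝ) * L) ^ m ≤ C * Real.exp m := by
    have hr : 0 ≤ √(m : ℝ) * L := by positivity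
    refine norm_coeff_mul_pow_le hr (hb _ hr) (fun z hz => (hC z).trans ?_) α
    have hsum : ∑ j, ‖z j‖ ^ 2 = n * (m * L ^ 2) := by
      simp [hz, mul_pow]
    have hquot : 1 / ((n + 1) * L ^ 2) * (n * (m * L ^ 2)) = m * (n / (n + 1 : ℝ)) := by
      field_simp
    rw [hsum, hquot]
    gcongr
    exact mul_le_of_le_one_right (by positivity) ((div_le_one (by positivity)).2 (by linarith))
  refine le_of_mul_le_mul_right ?_ (Real.exp_pos m)
  calc ‖b α‖ * √(m : ℝ) ^ m * T ^ m * Real.exp m = ‖b α‖ * (√(m : ℝ) * L) ^ m := by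
        rw [mul_pow, hL, mul_pow, ← Real.exp_nat_mul, mul_one]
        ring
    _ ≤ C * Real.exp m := hcauchy

theorem GaussIntegrable.rapidDecay_hermiteCoeff (hf : GaussIntegrable f)
    (hgrowth : ∀ δ > 0, ∃ C, ∀ z, ‖bargmann f z‖ ≤ C * Real.exp (δ * ∑ j, ‖z j‖ ^ 2)) :
    RapidDecay (hermiteCoeff f) := by
  refine RapidDecay.of_bound fun T hT => ?_
  obtain ⟨C, hC⟩ := hf.rapidDecay_fockWeight_mul_hermiteCoeff.exists_norm_mul_sqrt_pow_mul_pow_le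
    (by simpa only [hf.bargmann_eq] using hgrowth) hT
  refine ⟨C, fun α => le_trans ?_ (hC α)⟩
  rw [norm_mul, norm_fockWeight]
  calc ‖hermiteCoeff f α‖ * T ^ multiDegree α
      ≤ (fockWeight α * √(multiDegree α : ℝ) ^ multiDegree α) *
          (‖hermiteCoeff f α‖ * T ^ multiDegree α) :=
        le_mul_of_one_le_left (by positivity) (one_le_fockWeight_mul_sqrt_pow α)
    _ = fockWeight α * ‖hermiteCoeff f α‖ * √(multiDegree α : ℝ) ^ multiDegree α *
          T ^ multiDegree α := by ring

end MinimalType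

section CriticalGaussDecay

variable {n : ℕ} {f : EuclideanSpace ℝ (Fin n) → ℂ}

/-- `|f(x)| = O(exp((ε - 1/2)|x|²))` for every `ε > 0`. For continuous functions this is the
condition that the Pfannschmidt condition imposes on `f` (with `a = 1`) and on the Fourier
transform of `f` (with `b = 1`). -/
def CriticalGaussDecay (f : EuclideanSpace ℝ (Fin n) → ℂ) : Prop :=
  ∀ ε > 0, ∃ C, ∀ x, ‖f x‖ ≤ C * Real.exp ((ε - 1 / 2) * ‖x‖ ^ 2)

theorem CriticalGaussDecay.integrable (hdecay : CriticalGaussDecay f) (hf : Continuous f) :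
    Integrable f := by
  obtain ⟨C, hC⟩ := hdecay (1 / 4) (by norm_num)
  refine memLp_one_iff_integrable.1 (memLp_of_norm_le_gaussian hf (b := 1 / 4) (C := C)
    (by norm_num) (fun x => ?_) 1)
  convert hC x using 4
  norm_num

theorem RapidDecay.criticalGaussDecay_hermiteSeries {c : (Fin n → ℕ) → ℂ} (hc : RapidDecay c) :
    CriticalGaussDecay (hermiteSeries c) := fun _ hε => ⟨_, hc.norm_hermiteSeries_le hε⟩

theorem norm_bargmannKernel_le (z : Fin n → ℂ) (x : EuclideanSpace ℝ (Fin n)) {η : ℝ}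
    (hη : 0 < η) :
    ‖bargmannKernel z x‖ ≤ (√√Real.pi)⁻¹ ^ n *
      (Real.exp ((∑ j, (z j).im ^ 2) / 2 + (1 / (2 * η) - 1 / 2) * ∑ j, (z j).re ^ 2) *
        Real.exp ((η - 1 / 2) * ‖x‖ ^ 2)) := by
  have hexponent : (-(∑ j, z j ^ 2) / 2 + √2 * ∑ j, (x j : ℂ) * z j - (‖x‖ : ℂ) ^ 2 / 2).re =
      (∑ j, (z j).im ^ 2) / 2 - (∑ j, (z j).re ^ 2) / 2 + ∑ j, √2 * x j * (z j).re -
        ‖x‖ ^ 2 / 2 := by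
    have hsq (w : ℂ) : (w ^ 2).re = w.re ^ 2 - w.im ^ 2 := by rw [sq, Complex.mul_re]; ring
    simp only [Complex.sub_re, Complex.add_re, Complex.div_ofNat_re, Complex.neg_re,
      Complex.re_sum, Finset.mul_sum, hsq, Finset.sum_sub_distrib, Complex.re_ofReal_mul,
      Complex.ofReal_re, Complex.ofReal_im, mul_assoc]
    ring
  have hcross : ∑ j, √2 * x j * (z j).re ≤ η * ‖x‖ ^ 2 + 1 / (2 * η) * ∑ j, (z j).re ^ 2 := by
    rw [EuclideanSpace.real_norm_sq_eq, Finset.mul_sum, Finset.mul_sum, ← Finset.sum_add_distrib]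
    gcongr with j
    have hsquare : η * x j ^ 2 + 1 / (2 * η) * (z j).re ^ 2 - √2 * x j * (z j).re =
        (√2 * η * x j - (z j).re) ^ 2 / (2 * η) := by
      field_simp
      linear_combination -(η ^ 2 * x j ^ 2) * Real.sq_sqrt (zero_le_two (α := ℝ))
    rw [← sub_nonneg, hsquare]
    positivity
  rw [bargmannKernel, norm_mul, Complex.norm_real, Real.norm_of_nonneg (by positivity),
    Complex.norm_exp, hexponent, ← Real.exp_add]
  gcongr
  linarith

theorem CriticalGaussDecay.exists_norm_bargmann_le (hdecay : CriticalGaussDecay f) {ε : ℝ}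
    (hε : 0 < ε) :
    ∃ C, 0 ≤ C ∧ ∀ z, ‖bargmann f z‖ ≤
      C * Real.exp ((∑ j, (z j).im ^ 2) / 2 + ε * ∑ j, (z j).re ^ 2) := by
  -- `η` is chosen such that the kernel bound has exactly the coefficient `ε` of `(re z)²`.
  set η := 1 / (1 + 2 * ε) with hη_def
  have hη : 0 < η := by positivity
  have hη_lt : η < 1 := (div_lt_one (by positivity)).2 (by linarith)
  have hcoef : 1 / (2 * η) - 1 / 2 = ε := by rw [hη_def]; field_simp; ring
  obtain ⟨C, hC⟩ := hdecay ((1 - η) / 2) (by linarith)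
  have hC0 : 0 ≤ C := nonneg_of_mul_nonneg_left ((norm_nonneg _).trans (hC 0)) (Real.exp_pos _)
  set I := ∫ x : EuclideanSpace ℝ (Fin n), Real.exp (-((1 - η) / 2) * ‖x‖ ^ 2)
  have : 0 ≤ I := integral_nonneg fun _ => (Real.exp_pos _).le
  refine ⟨C * (√√Real.pi)⁻¹ ^ n * I, by positivity, fun z => ?_⟩
  set E := Real.exp ((∑ j, (z j).im ^ 2) / 2 + ε * ∑ j, (z j).re ^ 2)
  have hint : Integrable fun x : EuclideanSpace ℝ (Fin n) =>
      C * (√√Real.pi)⁻¹ ^ n * E * Real.exp (-((1 - η) / 2) * ‖x‖ ^ 2) :=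
    (integrable_exp_neg_mul_norm_sq (by linarith)).const_mul _
  refine (norm_integral_le_of_norm_le hint (Eventually.of_forall fun x => ?_)).trans_eq ?_
  · have hkernel := norm_bargmannKernel_le z x hη
    rw [hcoef] at hkernel
    calc ‖f x * bargmannKernel z x‖
        ≤ C * Real.exp (((1 - η) / 2 - 1 / 2) * ‖x‖ ^ 2) *
            ((√√Real.pi)⁻¹ ^ n * (E * Real.exp ((η - 1 / 2) * ‖x‖ ^ 2))) :=
          (norm_mul_le _ _).trans (mul_le_mul (hC x) hkernel (norm_nonneg _) (by positivity))
      _ = C * (√√Real.pi)⁻¹ ^ n * E * (Real.exp (((1 - η) / 2 - 1 / 2) * ‖x‖ ^ 2) *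
            Real.exp ((η - 1 / 2) * ‖x‖ ^ 2)) := by ring
      _ = C * (√√Real.pi)⁻¹ ^ n * E * Real.exp (-((1 - η) / 2) * ‖x‖ ^ 2) := by
          rw [← Real.exp_add]
          ring_nf
  · rw [integral_const_mul]
    ring

theorem rapidDecay_hermiteCoeff_of_criticalGaussDecay (hf : Integrable f)
    (hdecay : CriticalGaussDecay f) (hdecay' : CriticalGaussDecay (unitaryFourier f)) :
    RapidDecay (hermiteCoeff f) := by
  have hgauss := gaussIntegrable_of_integrable hf
  refine hgauss.rapidDecay_hermiteCoeff fun δ hδ =>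
    exists_minimalType_bound hgauss.differentiable_bargmann (fun ε hε => ?_) hδ
  obtain ⟨C₁, hC₁, hf_le⟩ := hdecay.exists_norm_bargmann_le hε
  obtain ⟨C₂, -, hfourier_le⟩ := hdecay'.exists_norm_bargmann_le hε
  refine ⟨max C₁ C₂, hC₁.trans (le_max_left _ _), fun z => ⟨(hf_le z).trans ?_, ?_⟩⟩
  · gcongr
    exact le_max_left _ _
  · have hrotate : bargmann (unitaryFourier f) (fun j => Complex.I * z j) = bargmann f z := by
      simp only [bargmann_unitaryFourier hf, ← mul_assoc, neg_mul, Complex.I_mul_I, neg_neg,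
        one_mul]
    have hbound := hfourier_le fun j => Complex.I * z j
    simp only [hrotate, Complex.I_mul_im, Complex.I_mul_re, neg_sq] at hbound
    refine hbound.trans ?_
    gcongr
    exact le_max_right _ _

theorem exists_eq_hermiteSeries_iff (hf : Continuous f) :
    (∃ c, RapidDecay c ∧ f = hermiteSeries c) ↔
      CriticalGaussDecay f ∧ CriticalGaussDecay (unitaryFourier f) := by
  constructor
  · rintro ⟨c, hc, rfl⟩
    rw [hc.unitaryFourier_hermiteSeries]
    exact ⟨hc.criticalGaussDecay_hermiteSeries, hc.neg_I_pow_mul.criticalGaussDecay_hermiteSeries⟩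
  · rintro ⟨hdecay, hdecay'⟩
    have hint := hdecay.integrable hf
    have hc := rapidDecay_hermiteCoeff_of_criticalGaussDecay hint hdecay hdecay'
    exact ⟨_, hc, (gaussIntegrable_of_integrable hint).eq_hermiteSeries hf hc⟩

end CriticalGaussDecay

section Pfannschmidt

variable {n : ℕ} {f : EuclideanSpace ℝ (Fin n) → ℂ} {P : EuclideanSpace ℝ (Fin n) → ℝ}

theorem tendsto_norm_sq_cobounded {V : Type*} [SeminormedAddCommGroup V] :
    Tendsto (fun x : V => ‖x‖ ^ 2) (Bornology.cobounded V) atTop :=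
  (tendsto_pow_atTop two_ne_zero).comp tendsto_norm_cobounded_atTop

theorem logLimsupZero_of_le_exp (hn : 1 ≤ n) (hP : ∀ x, 1 ≤ P x)
    (h : ∀ ε > 0, ∃ C > 0, ∀ x, P x ≤ C * Real.exp (ε * ‖x‖ ^ 2)) : LogLimsupZero P := by
  have : Nonempty (Fin n) := ⟨⟨0, hn⟩⟩
  have hlim : Tendsto (fun x => Real.log (P x) / ‖x‖ ^ 2)
      (Bornology.cobounded (EuclideanSpace ℝ (Fin n))) (𝓝 0) := by
    refine tendsto_order.2 ⟨fun a ha => Eventually.of_forall fun x => ha.trans_le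
      (div_nonneg (Real.log_nonneg (hP x)) (by positivity)), fun ε hε => ?_⟩
    obtain ⟨C, hC, hPC⟩ := h (ε / 2) (half_pos hε)
    filter_upwards [(tendsto_norm_sq_cobounded.const_div_atTop (Real.log C)).eventually_lt_const
      (half_pos hε), tendsto_norm_sq_cobounded.eventually_gt_atTop 0] with x hlogC hx
    calc Real.log (P x) / ‖x‖ ^ 2
        ≤ Real.log (C * Real.exp (ε / 2 * ‖x‖ ^ 2)) / ‖x‖ ^ 2 := by
          gcongr
          exacts [one_pos.trans_le (hP x), hPC x]
      _ = Real.log C / ‖x‖ ^ 2 + ε / 2 := by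
          rw [Real.log_mul hC.ne' (Real.exp_pos _).ne', Real.log_exp, add_div,
            mul_div_cancel_right₀ _ hx.ne']
      _ < ε := by linarith
  exact ((continuous_coe_real_ereal.tendsto 0).comp hlim).limsup_eq

theorem LogLimsupZero.eventually_le_exp (hP : LogLimsupZero P) (hpos : ∀ x, 0 < P x) {ε : ℝ}
    (hε : 0 < ε) :
    ∀ᶠ x in Bornology.cobounded (EuclideanSpace ℝ (Fin n)), P x ≤ Real.exp (ε * ‖x‖ ^ 2) := by
  have hlt : limsup (fun x => ((Real.log (P x) / ‖x‖ ^ 2 : ℝ) : EReal))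
      (Bornology.cobounded (EuclideanSpace ℝ (Fin n))) < (ε : EReal) :=
    hP.trans_lt (EReal.coe_pos.2 hε)
  filter_upwards [eventually_lt_of_limsup_lt hlt,
    tendsto_norm_sq_cobounded.eventually_gt_atTop 0] with x hlog hx
  rw [← Real.log_le_iff_le_exp (hpos x), ← div_le_iff₀ hx]
  exact (EReal.coe_lt_coe_iff.1 hlog).le

theorem CriticalGaussDecay.exists_logLimsupZero (hn : 1 ≤ n) (hf : CriticalGaussDecay f) :
    ∃ P : EuclideanSpace ℝ (Fin n) → ℝ, (∀ x, 0 < P x) ∧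
      (∀ x, ‖f x‖ ≤ P x * Real.exp (-(1 / 2) * 1 * ‖x‖ ^ 2)) ∧ LogLimsupZero P := by
  refine ⟨fun x => 1 + ‖f x‖ * Real.exp (1 / 2 * ‖x‖ ^ 2), fun x => by positivity, fun x => ?_,
    logLimsupZero_of_le_exp hn (fun x => le_add_of_nonneg_right (by positivity)) fun ε hε => ?_⟩
  · rw [mul_one, add_mul, mul_assoc ‖f x‖, ← Real.exp_add, neg_mul, add_neg_cancel,
      Real.exp_zero, mul_one]
    exact le_add_of_nonneg_left (by positivity)
  · obtain ⟨C, hC⟩ := hf ε hε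
    have hC0 : 0 ≤ C :=
      nonneg_of_mul_nonneg_left ((norm_nonneg _).trans (hC 0)) (Real.exp_pos _)
    refine ⟨1 + C, by positivity, fun x => ?_⟩
    calc 1 + ‖f x‖ * Real.exp (1 / 2 * ‖x‖ ^ 2)
        ≤ Real.exp (ε * ‖x‖ ^ 2) +
            C * Real.exp ((ε - 1 / 2) * ‖x‖ ^ 2) * Real.exp (1 / 2 * ‖x‖ ^ 2) := by
          gcongr
          exacts [Real.one_le_exp (by positivity), hC x]
      _ = (1 + C) * Real.exp (ε * ‖x‖ ^ 2) := by
          rw [mul_assoc, ← Real.exp_add]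
          ring_nf

theorem LogLimsupZero.criticalGaussDecay (hP : LogLimsupZero P) (hpos : ∀ x, 0 < P x)
    (hf : Continuous f) (hfP : ∀ x, ‖f x‖ ≤ P x * Real.exp (-(1 / 2) * 1 * ‖x‖ ^ 2)) :
    CriticalGaussDecay f := by
  intro ε hε
  let g : EuclideanSpace ℝ (Fin n) → ℝ := fun x => ‖f x‖ * Real.exp ((1 / 2 - ε) * ‖x‖ ^ 2)
  have hg_far : ∀ᶠ x in cocompact (EuclideanSpace ℝ (Fin n)), g x ≤ 1 := by
    rw [← Metric.cobounded_eq_cocompact]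
    filter_upwards [hP.eventually_le_exp hpos hε] with x hx
    calc ‖f x‖ * Real.exp ((1 / 2 - ε) * ‖x‖ ^ 2)
        ≤ Real.exp (ε * ‖x‖ ^ 2) * Real.exp (-(1 / 2) * 1 * ‖x‖ ^ 2) *
            Real.exp ((1 / 2 - ε) * ‖x‖ ^ 2) := by
          gcongr
          exact (hfP x).trans (by gcongr)
      _ = 1 := by
          rw [← Real.exp_add, ← Real.exp_add, Real.exp_eq_one_iff]
          ring
  obtain ⟨K, hK, hKfar⟩ := mem_cocompact.1 hg_far
  obtain ⟨M, hM⟩ := hK.bddAbove_image (f := g) (by fun_prop)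
  refine ⟨max M 1, fun x => ?_⟩
  have hg : g x ≤ max M 1 := by
    by_cases hx : x ∈ K
    exacts [(hM ⟨x, hx, rfl⟩).trans (le_max_left _ _), (hKfar hx).trans (le_max_right _ _)]
  rwa [← le_div_iff₀ (Real.exp_pos _), div_eq_mul_inv, ← Real.exp_neg, ← neg_mul, neg_sub] at hg

theorem pfannschmidtCondition_iff (hn : 1 ≤ n) (hf : Continuous f) :
    PfannschmidtCondition 1 1 f ↔ ∃ c, RapidDecay c ∧ f = hermiteSeries c := by
  rw [exists_eq_hermiteSeries_iff hf]
  constructor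
  · rintro ⟨-, P, Q, hP, hQ, hfP, hfQ, hPlim, hQlim⟩
    have hdecay := hPlim.criticalGaussDecay hP hf hfP
    have hcont := continuous_unitaryFourier (hdecay.integrable hf)
    exact ⟨hdecay, hQlim.criticalGaussDecay hQ hcont hfQ⟩
  · rintro ⟨hdecay, hdecay'⟩
    obtain ⟨P, hP, hfP, hPlim⟩ := hdecay.exists_logLimsupZero hn
    obtain ⟨Q, hQ, hfQ, hQlim⟩ := hdecay'.exists_logLimsupZero hn
    exact ⟨hf.measurable, P, Q, hP, hQ, hfP, hfQ, hPlim, hQlim⟩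

end Pfannschmidt

end

theorem theorem1p4 (n : ℕ) (hn : 1 ≤ n) (F : EuclideanSpace ℂ (Fin n) → ℂ)
    (hF : Differentiable ℂ F) :
    (F ∈ HermiteBergmanInf n ↔ PfannschmidtCondition 1 1 (realRestriction F)) ∧
    (F ∈ HermiteBergmanInf n →
      Integrable (realRestriction F) volume ∧
      ∃ G ∈ HermiteBergmanInf n,
        (∀ ξ, realRestriction G ξ = unitaryFourier (realRestriction F) ξ) ∧
        IsEntireOrderTwoMinimalType (mulExpHalfSq F) ∧
        IsEntireOrderTwoMinimalType (mulExpHalfSq G)) := by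
  refine ⟨?_, fun hmem => ?_⟩
  · have hcont : Continuous (realRestriction F) := hF.continuous.comp continuous_realToComplex
    rw [mem_hermiteBergmanInf_iff, pfannschmidtCondition_iff hn hcont]
    exact exists_congr fun c => and_congr_right fun hc => hc.eq_hermiteEntire_iff hF
  · obtain ⟨c, hc, rfl⟩ := mem_hermiteBergmanInf_iff.1 hmem
    have hd := hc.neg_I_pow_mul
    simp only [realRestriction_hermiteEntire, hc.unitaryFourier_hermiteSeries]
    refine ⟨hc.integrable_hermiteSeries, _, hd.hermiteEntire_mem, fun ξ => ?_, ?_, ?_⟩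
    · rw [realRestriction_hermiteEntire]
    · rw [mulExpHalfSq_hermiteEntire]
      exact hc.isEntireOrderTwoMinimalType
    · rw [mulExpHalfSq_hermiteEntire]
      exact hd.isEntireOrderTwoMinimalType
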